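/- **Theorem 4.** A *circle-centered (MBCC) arrangement* is a pair $(\mathcal S,D)$ of a finite family of circles in $\mathbb R^2$ and a region, built as follows. Start with a non-empty finite family of mutually disjoint circles and a bounded connected component $D$ of the complement of their union such that $\partial\overline D$ is the union of all the circles. Then repeatedly choose a point $p$ on a circle of $\mathcal S$ and a sufficiently small radius $r>0$, add the circle $S_{p,r}$ of center $p$ and radius $r$ to $\mathcal S$, and remove from $D$ the closed disk bounded by $S_{p,r}$. The *Poincaré–Reeb V-digraph* $W_{D,i}$ ($i=1,2$) is the quotient of $\overline D$ by the relation identifying points in the same connected component of the same fiber of the $i$-th coordinate on $\overline D$. Its vertices are the classes containing a point of $\overline D$ at which the $i$-th coordinate is extremal on some circle of $\mathcal S$, or a point common to two distinct circles of $\mathcal S$. Its edges are oriented by increasing $i$-th coordinate and its vertices are labelled by their $i$-th coordinates. Isomorphisms of V-digraphs preserve orientations and the order of the labels (equal labels correspond to equal labels). Let $(\mathcal S,D)$ be a circle-centered arrangement, let $p\in\overline D$ lie on exactly two distinct circles $S_1,S_2\in\mathcal S$, and let $(\mathcal S',D')$ be obtained by adding $S_{p,r}$ as above. For $a=1,2$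 let $v_a$ be the *canonical angle segment*: the vector such that $p\pm v_a$ are the points where the tangent line of $S_a$ at $p$ meets $S_{p,r}$ and $p+v_a$ is closer than $p-v_a$ to $D\cap S_{p,r}$; write $v_a=(v_{a,1},v_{a,2})$. If all radii in the construction, including the last radius $r$, are sufficiently small (each one depending on the arrangement and the center at that step), then none of the following occurs: 1. (case (5.1)) $v_{1,1}v_{2,1}>0$ and $v_{1,2}v_{2,2}>0$; 2. (case (5.2.2)) $v_{1,1}v_{2,1}>0$ and $v_{1,2}v_{2,2}<0$, and $W_{D',1}$ is isomorphic to a V-digraph obtained from $W_{D,1}$ as follows: choose a vertex $v_0$ of degree $1$ whose label is the first coordinate of $p$ and an edge departing from $v_0$; add two new vertices with one and the same label, slightly greater than the label of $v_0$, and two new edges departing from these vertices and entering $v_0$; then replace the label of $v_0$ by one slightly greater than that of the new vertices (or the same with the edges reversed and "smaller" in place of "greater"). The same holds with the two coordinates exchanged and $W_{D,2},W_{D',2}$ in place of $W_{D,1},W_{D',1}$; 3. (case (5.4)) $v_{1,1}v_{2,1}<0$ and $v_{1,2}v_{2,2}<0$. -/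

import Mathlib

open Set

/-- The Euclidean plane. -/
abbrev Plane : Type := EuclideanSpace ℝ (Fin 2)

/-- A circle of positive radius in the plane, given by its center and its radius. -/
structure PlaneCircle where
  center : Plane
  radius : ℝ
  radius_pos : 0 < radius

/-- The set of points of a circle. -/
def PlaneCircle.carrier (c : PlaneCircle) : Set Plane := Metric.sphere c.center c.radius

/-- The two points of `c` at which the `i`-th coordinate is extremal on `c`. For `i = 0` these are
the points with a vertical tangent line, for `i = 1` those with a horizontal tangent line. -/
def PlaneCircle.IsPole (c : PlaneCircle) (i : Fin 2) (x : Plane) : Prop :=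
  x = c.center + EuclideanSpace.single i c.radius ∨
    x = c.center - EuclideanSpace.single i c.radius

/-- The union of all circles of a family. -/
def unionOfCircles (S : Set PlaneCircle) : Set Plane := ⋃ c ∈ S, c.carrier

/-- `D` is a bounded connected component of the complement of the circles of `S`. -/
def IsBoundedRegion (S : Set PlaneCircle) (D : Set Plane) : Prop :=
  Bornology.IsBounded D ∧
    ∃ x ∈ (unionOfCircles S)ᶜ, D = connectedComponentIn (unionOfCircles S)ᶜ x

/-- Circle-centered arrangements, built step by step. One starts from finitely many (at least one)
mutually disjoint circles which together bound a bounded region, and repeatedly adds a small circle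
centered at a point of a circle that is already present, removing its closed disk from the region.
The function `δ` says how small: in the arrangement `(S, D)` a circle centered at `p` may be added
when its radius is smaller than `δ S D p`. -/
inductive IsCircleCentered (δ : Set PlaneCircle → Set Plane → Plane → ℝ) :
    Set PlaneCircle → Set Plane → Prop
  | base {S : Set PlaneCircle} {D : Set Plane} (finite : S.Finite) (nonempty : S.Nonempty)
      (disjoint : S.PairwiseDisjoint PlaneCircle.carrier) (region : IsBoundedRegion S D)
      (boundary : frontier (closure D) = unionOfCircles S) : IsCircleCentered δ S D
  | step {S : Set PlaneCircle} {D : Set Plane} {c : PlaneCircle} {p : Plane} {r : ℝ}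
      (arr : IsCircleCentered δ S D) (mem : c ∈ S) (on : p ∈ c.carrier)
      (pos : 0 < r) (small : r < δ S D p) :
      IsCircleCentered δ (insert ⟨p, r, pos⟩ S) (D \ Metric.closedBall p r)

/-! ### Oriented graphs with real labels at the vertices -/

/-- A directed multigraph with real labels at its vertices that increase along the edges:
`departs e v` says that `e` departs from `v`, and `enters e v` that `e` enters `v`. -/
structure VDigraph where
  V : Type
  E : Type
  departs : E → V → Prop
  enters : E → V → Prop
  label : V → ℝ
  label_lt : ∀ e v w, departs e v → enters e w → label v < label w

namespace VDigraph

/-- The number of edges containing a vertex. -/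
noncomputable def degree (G : VDigraph) (v : G.V) : ℕ∞ :=
  {e : G.E | G.departs e v ∨ G.enters e v}.encard

/-- Isomorphisms preserve incidence, orientations, and the order of the labels. -/
structure Iso (G H : VDigraph) where
  toV : G.V ≃ H.V
  toE : G.E ≃ H.E
  departs_iff : ∀ e v, G.departs e v ↔ H.departs (toE e) (toV v)
  enters_iff : ∀ e v, G.enters e v ↔ H.enters (toE e) (toV v)
  label_lt_iff : ∀ v w, G.label v < G.label w ↔ H.label (toV v) < H.label (toV w)

/-- All edges are reversed, all labels change their sign. -/
def reverse (G : VDigraph) : VDigraph where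
  V := G.V
  E := G.E
  departs := G.enters
  enters := G.departs
  label := fun v => -G.label v
  label_lt := fun e v w hv hw => neg_lt_neg (G.label_lt e w v hw hv)

open Classical in
/-- Two new vertices with the common label `a` and two new edges, each departing from one of the new
vertices and entering `v₀`, are added, and `v₀` gets the new label `b` instead of its old one. Here
`a` and `b` lie above the old label of `v₀` and below all labels that are greater than it. -/
noncomputable def splitEnd (G : VDigraph) (v₀ : G.V) (a b : ℝ) (ha : G.label v₀ < a) (hab : a < b)
    (hb : ∀ w, G.label v₀ < G.label w → b < G.label w) : VDigraph where
  V := G.V ⊕ Fin 2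
  E := G.E ⊕ Fin 2
  departs := fun e v => match e, v with
    | .inl e, .inl v => G.departs e v
    | .inr k, .inr l => k = l
    | _, _ => False
  enters := fun e v => match e, v with
    | .inl e, .inl v => G.enters e v
    | .inr _, .inl v => v = v₀
    | _, _ => False
  label := Sum.elim (fun v => if v = v₀ then b else G.label v) (fun _ => a)
  label_lt := by
    rintro (e | k) (v | l) (w | m) h₁ h₂ <;> try exact False.elim h₁
    all_goals try exact False.elim h₂
    · have h := G.label_lt e v w h₁ h₂
      simp only [Sum.elim_inl]
      by_cases hv : v = v₀
      · subst hv
        have hw : w ≠ v := by rintro rfl; exact lt_irrefl _ h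
        simpa [hw] using hb w h
      · by_cases hw : w = v₀
        · subst hw
          simpa [hv] using h.trans (ha.trans hab)
        · simpa [hv, hw] using h
    · have hw : w = v₀ := h₂
      simpa [hw] using hab

/-- `H` is isomorphic to a graph obtained from `G` as follows: choose a vertex `v₀` of degree `1`
with label `x` and an edge departing from `v₀`; add two vertices with one and the same label,
greater than `x` and close to it, and two edges departing from these vertices and entering `v₀`;
finally replace the label of `v₀` by a greater one, close to the label of the new vertices.
Since isomorphisms only see the order of the labels, a label greater than `x` is close to `x` when
it is smaller than all old labels greater than `x`. -/
def IsForwardSplit (G H : VDigraph) (x : ℝ) : Prop :=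
  ∃ (v₀ : G.V) (a b : ℝ) (ha : G.label v₀ < a) (hab : a < b)
    (hb : ∀ w, G.label v₀ < G.label w → b < G.label w),
    G.label v₀ = x ∧ G.degree v₀ = 1 ∧ (∃ e₀, G.departs e₀ v₀) ∧
      Nonempty (Iso H (G.splitEnd v₀ a b ha hab hb))

/-- The change `IsForwardSplit`, or the same change with all edges reversed and with `smaller` in
place of `greater`. -/
def IsSplit (G H : VDigraph) (x : ℝ) : Prop :=
  IsForwardSplit G H x ∨ IsForwardSplit G.reverse H.reverse (-x)

end VDigraph

/-! ### Poincaré-Reeb graphs -/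

/-- Two points of `X` are identified if they lie in the same connected component of the same fiber
of the `i`-th coordinate function on `X`. -/
def reebSetoid (X : Set Plane) (i : Fin 2) : Setoid X where
  r := fun x y => (y : Plane) ∈ connectedComponentIn (X ∩ {z | z i = (x : Plane) i}) (x : Plane)
  iseqv := by
    have level : ∀ {x y : X},
        (y : Plane) ∈ connectedComponentIn (X ∩ {z | z i = (x : Plane) i}) (x : Plane) →
          (y : Plane) i = (x : Plane) i :=
      fun h => (connectedComponentIn_subset _ _ h).2
    refine ⟨fun x => mem_connectedComponentIn ⟨x.2, rfl⟩, ?_, ?_⟩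
    · intro x y h
      rw [level h, ← connectedComponentIn_eq h]
      exact mem_connectedComponentIn ⟨x.2, rfl⟩
    · intro x y z h h'
      rw [level h, ← connectedComponentIn_eq h] at h'
      exact h'

/-- The space of all connected components of fibers of the `i`-th coordinate on `X`. -/
def ReebSpace (X : Set Plane) (i : Fin 2) : Type := Quotient (reebSetoid X i)

instance (X : Set Plane) (i : Fin 2) : TopologicalSpace (ReebSpace X i) :=
  inferInstanceAs (TopologicalSpace (Quotient (reebSetoid X i)))

/-- The quotient map. -/
def ReebSpace.mk (X : Set Plane) (i : Fin 2) (x : X) : ReebSpace X i :=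
  Quotient.mk (reebSetoid X i) x

/-- The function induced on the quotient by the `i`-th coordinate. -/
def ReebSpace.height {X : Set Plane} {i : Fin 2} : ReebSpace X i → ℝ :=
  Quotient.lift (fun x : X => (x : Plane) i)
    (fun _ _ h => (connectedComponentIn_subset _ _ h).2.symm)

/-- The classes that contain a pole (for the coordinate `i`) of a circle of `S` or a point common to
two distinct circles of `S`. -/
def preVertices (S : Set PlaneCircle) (X : Set Plane) (i : Fin 2) : Set (ReebSpace X i) :=
  {v | ∃ x : X, ReebSpace.mk X i x = v ∧
    ((∃ c ∈ S, c.IsPole i x) ∨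
      ∃ c₁ ∈ S, ∃ c₂ ∈ S, c₁ ≠ c₂ ∧ (x : Plane) ∈ c₁.carrier ∧ (x : Plane) ∈ c₂.carrier)}

/-- The Poincaré-Reeb V-digraph of `(S, D)` for the `i`-th coordinate. Its underlying space is the
quotient of the closure of `D`, its vertices are the pre-vertices, its (open) edges are the
connected components of the complement of the vertex set, it is oriented by increasing height, and
its vertices are labelled by their heights. -/
def poincareReeb (S : Set PlaneCircle) (D : Set Plane) (i : Fin 2) : VDigraph where
  V := preVertices S (closure D) i
  E := {e : Set (ReebSpace (closure D) i) // ∃ x ∈ (preVertices S (closure D) i)ᶜ,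
    e = connectedComponentIn (preVertices S (closure D) i)ᶜ x}
  departs := fun e v => v.1 ∈ closure e.1 ∧ ∀ x ∈ e.1, v.1.height < x.height
  enters := fun e v => v.1 ∈ closure e.1 ∧ ∀ x ∈ e.1, x.height < v.1.height
  label := fun v => v.1.height
  label_lt := by
    rintro ⟨e, x, hx, rfl⟩ v w hv hw
    exact (hv.2 x (mem_connectedComponentIn hx)).trans (hw.2 x (mem_connectedComponentIn hx))

/-! ### Adding a small circle centered at a common point of two circles -/

/-- `p` is a point of the closure of `D` that lies on the two distinct circles `c₁`, `c₂` of `S` and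
on no other circle of `S`. -/
structure IsDoublePoint (S : Set PlaneCircle) (D : Set Plane) (p : Plane) (c₁ c₂ : PlaneCircle) :
    Prop where
  mem_closure : p ∈ closure D
  mem₁ : c₁ ∈ S
  mem₂ : c₂ ∈ S
  ne : c₁ ≠ c₂
  on₁ : p ∈ c₁.carrier
  on₂ : p ∈ c₂.carrier
  only : ∀ c ∈ S, p ∈ c.carrier → c = c₁ ∨ c = c₂

/-- `v` is the canonical angle segment at `p` belonging to the circle `c` through `p`, as a vector
issuing from `p`. The tangent line of `c` at `p` meets the circle of radius `r` centered at `p` in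
the points `p + v` and `p - v`, and of these two `p + v` is the one that is closer to the part of
that circle in `D`. -/
def IsCanonicalSegment (D : Set Plane) (p : Plane) (r : ℝ) (c : PlaneCircle) (v : Plane) : Prop :=
  inner ℝ (p - c.center) v = 0 ∧ ‖v‖ = r ∧
    Metric.infDist (p + v) (D ∩ Metric.sphere p r) < Metric.infDist (p - v) (D ∩ Metric.sphere p r)

/-- The two canonical angle segments at `p` have both coordinates of equal signs. -/
def SameQuadrant (D : Set Plane) (p : Plane) (r : ℝ) (c₁ c₂ : PlaneCircle) : Prop :=
  ∃ v w : Plane, IsCanonicalSegment D p r c₁ v ∧ IsCanonicalSegment D p r c₂ w ∧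
    0 < v 0 * w 0 ∧ 0 < v 1 * w 1

/-- The two canonical angle segments at `p` have both coordinates of opposite signs. -/
def OppositeQuadrants (D : Set Plane) (p : Plane) (r : ℝ) (c₁ c₂ : PlaneCircle) : Prop :=
  ∃ v w : Plane, IsCanonicalSegment D p r c₁ v ∧ IsCanonicalSegment D p r c₂ w ∧
    v 0 * w 0 < 0 ∧ v 1 * w 1 < 0

/-- The two canonical angle segments at `p` have `i`-th coordinates of equal signs and other
coordinates of opposite signs, and the Poincaré-Reeb V-digraph for the `i`-th coordinate changes, up
to isomorphism, by a split at a vertex of degree `1` and label `p i` into two vertices with equal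
labels. -/
def EqualLabelSplit (S : Set PlaneCircle) (D : Set Plane) (p : Plane) (r : ℝ) (hr : 0 < r)
    (c₁ c₂ : PlaneCircle) (i : Fin 2) : Prop :=
  (∃ v w : Plane, IsCanonicalSegment D p r c₁ v ∧ IsCanonicalSegment D p r c₂ w ∧
    0 < v i * w i ∧ v i.rev * w i.rev < 0) ∧
  VDigraph.IsSplit (poincareReeb S D i)
    (poincareReeb (insert ⟨p, r, hr⟩ S) (D \ Metric.closedBall p r) i) (p i)

open Filter Topology

/-! ### Vectors of the plane -/

-- Cases (5.1) and (5.4) both say that the tangent lines of the two circles at `p` have slopes of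
-- equal sign, so it suffices that no crossing of the arrangement is of this kind. Crossings arise
-- only between a new small circle and an older circle `c` through its center. At such a crossing,
-- displaced by `m` from the new center, the normals are `N + m` and `m`, where `N` is the normal of
-- `c` at the new center. Here `⟨N + m, m⟩ = r² / 2`, while `⟨N, m⟩ = -r² / 2`. Slopes of equal sign
-- would make both coordinate products in `⟨N + m, m⟩` positive, and if `r` is below the nonzero `|N
-- i|`, this forces `⟨N, m⟩ ≥ 0` (`eventually_normals`). The induction carries this as `WellPlaced`,
-- together with transversality and distinct radii of circles that meet.
--
-- For case (5.2.2) the labels are counted. Near `p` the region is a sector between the two circles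
-- (`exists_isSector`); inversion at `p` turns it into an intersection of half planes. The sign
-- condition makes this sector open along the `i`-th axis (`eventually_canonical`, `sector_opens`).
-- Hence the small circle contributes two corners, where it meets the sides of the sector, and a
-- pole. Their three `i`-th coordinates are new and distinct; for the corners this is because the
-- radii of the two circles differ. All old labels survive, except possibly `p i`. A split adds at
-- most two labels to the old ones, and drops `p i` unless a second vertex carries it; but then that
-- vertex makes `p i` survive. Three new labels are therefore too many.

lemma Plane.inner_eq (x y : Plane) : inner ℝ x y = x 0 * y 0 + x 1 * y 1 := by
  simp [PiLp.inner_apply, Fin.sum_univ_two, mul_comm]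

lemma Plane.norm_sq_eq (x : Plane) : ‖x‖ ^ 2 = x 0 ^ 2 + x 1 ^ 2 := by
  simp [EuclideanSpace.real_norm_sq_eq, Fin.sum_univ_two]

lemma Plane.ext_coord {x y : Plane} (h₀ : x 0 = y 0) (h₁ : x 1 = y 1) : x = y := by
  ext i
  fin_cases i
  · exact h₀
  · exact h₁

/-- The determinant of two vectors of the plane. -/
def cross (x y : Plane) : ℝ := x 0 * y 1 - x 1 * y 0

lemma cross_swap (x y : Plane) : cross y x = -cross x y := by
  unfold cross
  ring

/-- The power of the point `p + m` with respect to the circle through `p` with center `p - n`. -/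
noncomputable def power (n m : Plane) : ℝ := ‖m‖ ^ 2 + 2 * inner ℝ n m

lemma power_sub (p q x : Plane) : power (p - q) (x - p) = ‖x - q‖ ^ 2 - ‖p - q‖ ^ 2 := by
  simp only [power, Plane.inner_eq, Plane.norm_sq_eq, PiLp.sub_apply]
  ring

lemma exists_inner_eq {n₁ n₂ : Plane} (h : cross n₁ n₂ ≠ 0) (s t : ℝ) :
    ∃ z : Plane, inner ℝ n₁ z = s ∧ inner ℝ n₂ z = t := by
  refine ⟨!₂[(s * n₂ 1 - t * n₁ 1) / cross n₁ n₂, (n₁ 0 * t - n₂ 0 * s) / cross n₁ n₂], ?_, ?_⟩ <;>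
  · simp only [Plane.inner_eq, Matrix.cons_val_zero, Matrix.cons_val_one]
    field_simp
    unfold cross
    ring

/-- Two independent linear forms determine a vector, hence control its norm. This will show that
points of an inverted sector on which the sum of the signed forms is bounded stay bounded. -/
lemma exists_norm_le {n₁ n₂ : Plane} (h : cross n₁ n₂ ≠ 0) :
    ∃ C, 0 < C ∧ ∀ (y : Plane) (B : ℝ), |inner ℝ n₁ y| ≤ B → |inner ℝ n₂ y| ≤ B → ‖y‖ ≤ C * B := by
  have hc : 0 < |cross n₁ n₂| := abs_pos.2 h
  refine ⟨(‖n₁‖ + ‖n₂‖) / |cross n₁ n₂| + 1, by positivity, fun y B h₁ h₂ => ?_⟩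
  have hB : 0 ≤ B := (abs_nonneg _).trans h₁
  -- Cramer's rule, in the form of an identity of vectors rotated by a right angle
  have key : ‖cross n₁ n₂ • y‖ ≤ ‖n₁‖ * B + ‖n₂‖ * B := by
    have e : ‖cross n₁ n₂ • y‖ = ‖(inner ℝ n₁ y : ℝ) • n₂ - (inner ℝ n₂ y : ℝ) • n₁‖ := by
      rw [← sq_eq_sq₀ (norm_nonneg _) (norm_nonneg _)]
      simp only [Plane.norm_sq_eq, Plane.inner_eq, PiLp.sub_apply, PiLp.smul_apply, smul_eq_mul,
        cross]
      ring
    rw [e]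
    refine (norm_sub_le _ _).trans ?_
    rw [norm_smul, norm_smul, Real.norm_eq_abs, Real.norm_eq_abs]
    nlinarith [mul_le_mul_of_nonneg_right h₁ (norm_nonneg n₂),
      mul_le_mul_of_nonneg_right h₂ (norm_nonneg n₁)]
  rw [norm_smul, Real.norm_eq_abs] at key
  have : ‖y‖ ≤ (‖n₁‖ + ‖n₂‖) / |cross n₁ n₂| * B := by
    rw [div_mul_eq_mul_div, le_div_iff₀ hc]
    linarith
  linarith

/-- Inversion at the unit circle. -/
noncomputable def invert (y : Plane) : Plane := (‖y‖ ^ 2)⁻¹ • y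

lemma norm_invert (y : Plane) : ‖invert y‖ = ‖y‖⁻¹ := by
  rcases eq_or_ne y 0 with rfl | hy
  · simp [invert]
  have : ‖y‖ ≠ 0 := norm_ne_zero_iff.2 hy
  rw [invert, norm_smul, Real.norm_eq_abs, abs_of_nonneg (by positivity)]
  field_simp

lemma invert_invert (y : Plane) : invert (invert y) = y := by
  rcases eq_or_ne y 0 with rfl | hy
  · simp [invert]
  have : ‖y‖ ≠ 0 := norm_ne_zero_iff.2 hy
  rw [invert, norm_invert, invert, smul_smul]
  have : (‖y‖⁻¹ ^ 2)⁻¹ * (‖y‖ ^ 2)⁻¹ = 1 := by field_simp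
  rw [this, one_smul]

/-- Inversion at `p` turns a circle through `p` into a line missing the origin and its sides into
half planes. Convexity thus becomes available for sectors bounded by arcs. -/
lemma power_invert (n : Plane) {y : Plane} (hy : y ≠ 0) :
    power n (invert y) = (‖y‖ ^ 2)⁻¹ * (1 + 2 * inner ℝ n y) := by
  have : ‖y‖ ≠ 0 := norm_ne_zero_iff.2 hy
  rw [power, norm_invert, invert, inner_smul_right]
  field_simp

lemma continuousOn_invert : ContinuousOn invert {0}ᶜ := by
  have hc : ContinuousOn (fun y : Plane => ‖y‖ ^ 2) {0}ᶜ := by fun_prop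
  refine ContinuousOn.smul (hc.inv₀ fun y hy => ?_) continuousOn_id
  have : ‖y‖ ≠ 0 := norm_ne_zero_iff.2 hy
  positivity

lemma mul_power_invert_pos {n y : Plane} {σ : ℝ} (hy : y ≠ 0) :
    0 < σ * power n (invert y) ↔ 0 < σ * (1 + 2 * inner ℝ n y) := by
  have : 0 < ‖y‖ := norm_pos_iff.2 hy
  rw [power_invert n hy, show σ * ((‖y‖ ^ 2)⁻¹ * (1 + 2 * inner ℝ n y)) =
    (‖y‖ ^ 2)⁻¹ * (σ * (1 + 2 * inner ℝ n y)) by ring, mul_pos_iff_of_pos_left (by positivity)]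

lemma mul_power_invert_nonneg {n y : Plane} {σ : ℝ} (hy : y ≠ 0) :
    0 ≤ σ * power n (invert y) ↔ 0 ≤ σ * (1 + 2 * inner ℝ n y) := by
  have : 0 < ‖y‖ := norm_pos_iff.2 hy
  rw [power_invert n hy, show σ * ((‖y‖ ^ 2)⁻¹ * (1 + 2 * inner ℝ n y)) =
    (‖y‖ ^ 2)⁻¹ * (σ * (1 + 2 * inner ℝ n y)) by ring, mul_nonneg_iff_of_pos_left (by positivity)]

/-! ### Sectors bounded by two circles -/

/-- Near `p`, at distances smaller than `ε`, the set `D` is the sector on one side (given by the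
signs `σ₁`, `σ₂`) of each of two circles that cross at `p` and have the centers `p - n₁`, `p - n₂`.
-/
structure IsSector (D : Set Plane) (p n₁ n₂ : Plane) (σ₁ σ₂ ε : ℝ) : Prop where
  cross_ne : cross n₁ n₂ ≠ 0
  sign₁ : σ₁ * σ₁ = 1
  sign₂ : σ₂ * σ₂ = 1
  pos : 0 < ε
  mem_iff : ∀ m : Plane, ‖m‖ < ε → (p + m ∈ D ↔ 0 < σ₁ * power n₁ m ∧ 0 < σ₂ * power n₂ m)

lemma IsSector.swap {D : Set Plane} {p n₁ n₂ : Plane} {σ₁ σ₂ ε : ℝ}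
    (h : IsSector D p n₁ n₂ σ₁ σ₂ ε) : IsSector D p n₂ n₁ σ₂ σ₁ ε where
  cross_ne := by rw [cross_swap]; exact neg_ne_zero.2 h.cross_ne
  sign₁ := h.sign₂
  sign₂ := h.sign₁
  pos := h.pos
  mem_iff m hm := by rw [h.mem_iff m hm, and_comm]

/-- A point that lies weakly on the right sides of both circles of a sector at `p` can be approached
in the sector by points that are farther from `p`. -/
lemma IsSector.eventually_mem_closure {D : Set Plane} {p n₁ n₂ : Plane} {σ₁ σ₂ ε : ℝ}
    (h : IsSector D p n₁ n₂ σ₁ σ₂ ε) : ∀ᶠ r in 𝓝[>] (0 : ℝ), ∀ m : Plane, ‖m‖ = r →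
      0 ≤ σ₁ * power n₁ m → 0 ≤ σ₂ * power n₂ m → p + m ∈ closure (D \ Metric.closedBall p r) := by
  -- The point `z` lies strictly inside both half planes, since `σ * (1 + 2 * σ) = σ + 2 > 0` for a
  -- sign `σ`.
  obtain ⟨z, hz₁, hz₂⟩ := exists_inner_eq h.cross_ne σ₁ σ₂
  have hw₁ : 0 < σ₁ * (1 + 2 * inner ℝ n₁ z) := by
    rw [hz₁]; nlinarith [h.sign₁, sq_nonneg (σ₁ + 1)]
  have hw₂ : 0 < σ₂ * (1 + 2 * inner ℝ n₂ z) := by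
    rw [hz₂]; nlinarith [h.sign₂, sq_nonneg (σ₂ + 1)]
  have hr₀ : ∀ᶠ r in 𝓝[>] (0 : ℝ), r < (‖z‖ + 1)⁻¹ ∧ r < ε := by
    have : (0 : ℝ) < (‖z‖ + 1)⁻¹ := by positivity
    exact nhdsWithin_le_nhds ((eventually_lt_nhds this).and (eventually_lt_nhds h.pos))
  filter_upwards [hr₀, self_mem_nhdsWithin] with r ⟨hrz, hrε⟩ (hr : 0 < r) m hm h₁ h₂
  have hm0 : m ≠ 0 := by rintro rfl; simp at hm; exact hr.ne hm
  set y := invert m with hy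
  have hmy : m = invert y := (invert_invert m).symm
  have hyn : ‖y‖ = r⁻¹ := by rw [hy, norm_invert, hm]
  have hzy : ‖z‖ < ‖y‖ := by
    have : ‖z‖ + 1 < r⁻¹ := by rwa [lt_inv_comm₀ (by positivity) hr]
    rw [hyn]; linarith
  have hy0 : y ≠ 0 := norm_pos_iff.1 ((norm_nonneg z).trans_lt hzy)
  rw [hmy, mul_power_invert_nonneg hy0] at h₁ h₂
  -- Moving from `y` towards `z` enters the open half planes and, as `z` is shorter than `y`,
  -- shortens the vector. After inversion the point moves away from `p`, out of the closed disk.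
  set f : ℝ → Plane := fun t => (1 - t) • y + t • z with hf
  have hf0 : f 0 = y := by simp [hf]
  have hfc : Continuous f := by fun_prop
  have lim : Tendsto (fun t => invert (f t)) (𝓝[>] 0) (𝓝 m) := by
    have : ContinuousAt invert (f 0) := by
      rw [hf0]
      exact continuousOn_invert.continuousAt (isOpen_compl_singleton.mem_nhds hy0)
    have := this.tendsto.comp hfc.continuousAt.tendsto
    rw [hf0, ← hmy] at this
    exact this.mono_left nhdsWithin_le_nhds
  refine mem_closure_of_tendsto (lim.const_add p) ?_
  have near : ∀ᶠ t in 𝓝[>] (0 : ℝ), ‖invert (f t)‖ < ε :=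
    lim.norm.eventually (eventually_lt_nhds (by rwa [hm]))
  have far : ∀ᶠ t in 𝓝[>] (0 : ℝ), f t ≠ 0 :=
    nhdsWithin_le_nhds (hfc.continuousAt.eventually_ne (by rwa [hf0]))
  filter_upwards [near, far, self_mem_nhdsWithin,
    nhdsWithin_le_nhds (eventually_lt_nhds (zero_lt_one' ℝ))] with t h₃ h₄ (ht : 0 < t) ht1
  have inn : ∀ n : Plane, inner ℝ n (f t) = (1 - t) * inner ℝ n y + t * inner ℝ n z := fun n => by
    simp only [hf, inner_add_right, inner_smul_right]
  refine ⟨(h.mem_iff _ h₃).2 ⟨?_, ?_⟩, ?_⟩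
  · rw [mul_power_invert_pos h₄, inn]
    nlinarith [mul_pos ht hw₁, mul_nonneg (sub_nonneg.2 ht1.le) h₁]
  · rw [mul_power_invert_pos h₄, inn]
    nlinarith [mul_pos ht hw₂, mul_nonneg (sub_nonneg.2 ht1.le) h₂]
  · have hlt : ‖f t‖ < ‖y‖ := by
      calc ‖f t‖ ≤ ‖(1 - t) • y‖ + ‖t • z‖ := norm_add_le _ _
        _ = (1 - t) * ‖y‖ + t * ‖z‖ := by
          rw [norm_smul, norm_smul, Real.norm_of_nonneg ht.le,
            Real.norm_of_nonneg (sub_nonneg.2 ht1.le)]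
        _ < ‖y‖ := by nlinarith
    rw [mem_closedBall_iff_norm, add_sub_cancel_left, norm_invert, not_le]
    rw [hyn] at hlt
    rwa [lt_inv_comm₀ hr (norm_pos_iff.2 h₄)]

/-- A set contained in the sector on one side of each of two circles, with no boundary point in this
sector near `p`, is this sector near `p`. -/
lemma exists_isSector {D : Set Plane} {p n₁ n₂ : Plane} {σ₁ σ₂ ε : ℝ} (hc : cross n₁ n₂ ≠ 0)
    (s₁ : σ₁ * σ₁ = 1) (s₂ : σ₂ * σ₂ = 1) (hε : 0 < ε) (hD : IsOpen D) (hp : p ∈ closure D)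
    (sub : ∀ m, p + m ∈ D → 0 < σ₁ * power n₁ m ∧ 0 < σ₂ * power n₂ m)
    (bd : ∀ m, p + m ∈ frontier D → ‖m‖ < ε → power n₁ m = 0 ∨ power n₂ m = 0) :
    ∃ ε', IsSector D p n₁ n₂ σ₁ σ₂ ε' := by
  obtain ⟨C, hC, hCy⟩ := exists_norm_le hc
  set l : Plane := σ₁ • n₁ + σ₂ • n₂ with hl
  have hlin : ∀ y, inner ℝ l y = σ₁ * inner ℝ n₁ y + σ₂ * inner ℝ n₂ y := fun y => by
    rw [hl, inner_add_left, inner_smul_left, inner_smul_left]; rfl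
  have σ₁le : σ₁ ≤ 1 := by nlinarith
  have σ₂le : σ₂ ≤ 1 := by nlinarith
  have aσ₁ : |σ₁| = 1 := by
    rw [← sq_eq_sq₀ (abs_nonneg _) zero_le_one, sq_abs]; linarith [sq σ₁]
  have aσ₂ : |σ₂| = 1 := by
    rw [← sq_eq_sq₀ (abs_nonneg _) zero_le_one, sq_abs]; linarith [sq σ₂]
  -- Chosen so that `M < inner ℝ l y` makes `y` long enough for `‖invert y‖ < ε`.
  set M : ℝ := (‖l‖ + 1) / ε with hM
  have hM0 : 0 < M := by positivity
  set T : Set Plane := {y | 0 < σ₁ * (1 + 2 * inner ℝ n₁ y)} ∩ {y | 0 < σ₂ * (1 + 2 * inner ℝ n₂ y)} ∩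
    {y | M < inner ℝ l y} with hT
  have hTc : Convex ℝ T := by
    intro x hx y hy a b ha hb hab
    obtain ⟨⟨hx₁, hx₂⟩, hx₃⟩ := hx
    obtain ⟨⟨hy₁, hy₂⟩, hy₃⟩ := hy
    have conv : ∀ {u v w : ℝ}, w < u → w < v → w < a * u + b * v := fun {u v w} hu hv => by
      rcases ha.eq_or_lt with rfl | ha
      · have : b = 1 := by linarith
        simp [this, hv]
      · calc w = a * w + b * w := by rw [← add_mul, hab, one_mul]
          _ < _ := by nlinarith
    refine ⟨⟨?_, ?_⟩, ?_⟩
    · refine (conv hx₁ hy₁).trans_eq ?_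
      rw [inner_add_right, inner_smul_right, inner_smul_right]
      linear_combination σ₁ * hab
    · refine (conv hx₂ hy₂).trans_eq ?_
      rw [inner_add_right, inner_smul_right, inner_smul_right]
      linear_combination σ₂ * hab
    · refine (conv hx₃ hy₃).trans_eq ?_
      rw [inner_add_right, inner_smul_right, inner_smul_right]
  have hT0 : ∀ y ∈ T, y ≠ 0 := by
    rintro y ⟨_, hy⟩ rfl
    simp only [mem_ofPred_eq, inner_zero_right] at hy
    linarith
  have hTε : ∀ y ∈ T, ‖invert y‖ < ε := by
    intro y hy
    have h1 : M < ‖l‖ * ‖y‖ := lt_of_lt_of_le hy.2 (real_inner_le_norm l y)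
    have h2 : (‖l‖ + 1) < ‖l‖ * ‖y‖ * ε := by
      rwa [hM, div_lt_iff₀ hε] at h1
    have hy0 : 0 < ‖y‖ := norm_pos_iff.2 (hT0 y hy)
    rw [norm_invert, inv_lt_comm₀ hy0 hε]
    by_contra hle
    push Not at hle
    have : ‖y‖ * ε ≤ 1 := by
      calc ‖y‖ * ε ≤ ε⁻¹ * ε := by gcongr
        _ = 1 := inv_mul_cancel₀ hε.ne'
    nlinarith [norm_nonneg l]
  have hTbig : ∀ y, 0 < σ₁ * (1 + 2 * inner ℝ n₁ y) → 0 < σ₂ * (1 + 2 * inner ℝ n₂ y) →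
      C * (M + 1) < ‖y‖ → y ∈ T := by
    intro y h₁ h₂ h₃
    refine ⟨⟨h₁, h₂⟩, ?_⟩
    -- Both signed forms exceed `-1/2`; if their sum is at most `M`, each is bounded by `M + 1` in
    -- absolute value, so `y` is short.
    by_contra hle
    simp only [mem_ofPred_eq, not_lt, hlin] at hle
    refine h₃.not_ge (hCy y (M + 1) ?_ ?_)
    · rw [← one_mul |_|, ← aσ₁, ← abs_mul, abs_le]
      constructor <;> nlinarith
    · rw [← one_mul |_|, ← aσ₂, ← abs_mul, abs_le]
      constructor <;> nlinarith
  set U : Set Plane := (fun y => p + invert y) '' T with hU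
  have hUc : IsPreconnected U := by
    refine hTc.isPreconnected.image _ (continuousOn_const.add (continuousOn_invert.mono ?_))
    exact fun y hy => hT0 y hy
  set ε' : ℝ := (C * (M + 1) + 1)⁻¹ with hε'
  have hε'0 : 0 < ε' := by positivity
  have hsec : ∀ m, ‖m‖ < ε' → 0 < σ₁ * power n₁ m → 0 < σ₂ * power n₂ m → p + m ∈ U := by
    intro m hm h₁ h₂
    have hm0 : m ≠ 0 := by rintro rfl; simp [power] at h₁
    have hi0 : invert m ≠ 0 := by
      intro h
      apply hm0
      rw [← invert_invert m, h]
      simp [invert]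
    refine ⟨invert m, hTbig _ ?_ ?_ ?_, by simp [invert_invert]⟩
    · rwa [← mul_power_invert_pos hi0, invert_invert]
    · rwa [← mul_power_invert_pos hi0, invert_invert]
    · rw [norm_invert]
      have := (lt_inv_comm₀ (norm_pos_iff.2 hm0) (by positivity)).1 hm
      linarith
  -- `U` is connected, contains no frontier point of `D` (there one power vanishes), and meets `D`
  -- because `p` is in the closure. So it lies in `D`.
  have hUD : U ⊆ D := by
    refine hUc.subset_left_of_subset_union hD isClosed_closure.isOpen_compl
      (disjoint_compl_right.mono_right (compl_subset_compl.2 subset_closure)) ?_ ?_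
    · rintro _ ⟨y, hy, rfl⟩
      by_contra hcon
      simp only [mem_union, mem_compl_iff, not_or, not_not] at hcon
      have hf : p + invert y ∈ frontier D := by
        rw [hD.frontier_eq]
        exact ⟨hcon.2, hcon.1⟩
      have h₁ := (mul_power_invert_pos (hT0 y hy)).2 hy.1.1
      have h₂ := (mul_power_invert_pos (hT0 y hy)).2 hy.1.2
      rcases bd _ hf (hTε y hy) with h | h
      · rw [h] at h₁; simp at h₁
      · rw [h] at h₂; simp at h₂
    · obtain ⟨x, hx, hd⟩ := Metric.mem_closure_iff.1 hp ε' hε'0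
      have hx' : p + (x - p) ∈ D := by simpa using hx
      have := sub _ hx'
      have := hsec (x - p) (by rwa [← dist_eq_norm, dist_comm]) this.1 this.2
      exact ⟨x, by simpa using this, hx⟩
  exact ⟨ε', hc, s₁, s₂, hε'0, fun m hm => ⟨sub m, fun h => hUD (hsec m hm h.1 h.2)⟩⟩

/-! ### Circles centered at a point of a circle -/

lemma eventually_lt_abs (a : ℝ) : ∀ᶠ r in 𝓝[>] (0 : ℝ), a ≠ 0 → r < |a| := by
  rcases eq_or_ne a 0 with rfl | ha
  · simp
  · filter_upwards [nhdsWithin_le_nhds (eventually_lt_nhds (abs_pos.2 ha))] with r hr _ using hr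

lemma Plane.abs_apply_le (x : Plane) (i : Fin 2) : |x i| ≤ ‖x‖ := by
  simpa using PiLp.norm_apply_le x i

/-- The hypothesis reads `0 < (a + m) * m`, and for `|m| < |a|` the sum `a + m` has the sign of `a`.
-/
lemma mul_nonneg_of_add_sq_pos {a m : ℝ} (h : a ≠ 0 → |m| < |a|) (hA : 0 < a * m + m ^ 2) :
    0 ≤ a * m := by
  by_contra! hneg
  have ha : a ≠ 0 := by rintro rfl; simp at hneg
  have h1 : |a * m| = -(a * m) := abs_of_neg hneg
  rw [abs_mul] at h1
  nlinarith [h ha, abs_nonneg m, sq_abs m]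

/-- The normal vectors at a common point of a circle and of a small circle centered on it. -/
lemma eventually_normals (N : Plane) (hN : N ≠ 0) : ∀ᶠ r in 𝓝[>] (0 : ℝ), r < ‖N‖ ∧
    ∀ m : Plane, ‖m‖ = r → power N m = 0 →
      cross (N + m) m ≠ 0 ∧ (N + m) 0 * (N + m) 1 * (m 0 * m 1) ≤ 0 := by
  filter_upwards [eventually_lt_abs (N 0), eventually_lt_abs (N 1), self_mem_nhdsWithin,
    nhdsWithin_le_nhds (eventually_lt_nhds (norm_pos_iff.2 hN))] with r h₀ h₁ (hr : 0 < r) hrN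
  refine ⟨hrN, fun m hm hp => ?_⟩
  have hr2 : r ^ 2 = m 0 ^ 2 + m 1 ^ 2 := by rw [← hm, Plane.norm_sq_eq]
  have hN2 := Plane.norm_sq_eq N
  rw [power, Plane.inner_eq, Plane.norm_sq_eq] at hp
  constructor
  · intro hcr
    have hcr' : N 0 * m 1 - N 1 * m 0 = 0 := by
      simp only [cross, PiLp.add_apply] at hcr
      linarith
    have key : (N 0 * m 0 + N 1 * m 1) ^ 2 = ‖N‖ ^ 2 * r ^ 2 := by
      rw [hr2, hN2]
      linear_combination (-(N 0 * m 1 - N 1 * m 0)) * hcr'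
    have : N 0 * m 0 + N 1 * m 1 = - r ^ 2 / 2 := by rw [hr2]; linarith
    rw [this] at key
    have hrr : r ^ 2 < ‖N‖ ^ 2 := by gcongr
    have : 0 < r ^ 2 := by positivity
    nlinarith
  · simp only [PiLp.add_apply]
    by_contra! hpos
    -- The two factors are the coordinate summands of `⟨N + m, m⟩`. Having a positive product and a
    -- positive sum, both are positive.
    have hAB : 0 < (N 0 * m 0 + m 0 ^ 2) * (N 1 * m 1 + m 1 ^ 2) := by
      refine hpos.trans_eq ?_
      ring
    have hsum : 0 < (N 0 * m 0 + m 0 ^ 2) + (N 1 * m 1 + m 1 ^ 2) := by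
      have : 0 < r ^ 2 := by positivity
      linarith
    have hA : 0 < N 0 * m 0 + m 0 ^ 2 := by
      by_contra! hle
      nlinarith
    have hB : 0 < N 1 * m 1 + m 1 ^ 2 := by
      by_contra! hle
      nlinarith
    have b₀ := mul_nonneg_of_add_sq_pos
      (fun h => ((Plane.abs_apply_le m 0).trans_eq hm).trans_lt (h₀ h)) hA
    have b₁ := mul_nonneg_of_add_sq_pos
      (fun h => ((Plane.abs_apply_le m 1).trans_eq hm).trans_lt (h₁ h)) hB
    have : 0 < r ^ 2 := by positivity
    linarith

/-! ### The shape of circle-centered arrangements -/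

/-- The properties of a circle-centered arrangement that matter: the region is open, is bounded by
the circles and lies on one side of each of them, and circles that meet have distinct radii, cross
transversally, and have tangent lines at the crossing whose slopes are not of equal signs. -/
structure WellPlaced (S : Set PlaneCircle) (D : Set Plane) : Prop where
  finite : S.Finite
  isOpen : IsOpen D
  frontier_subset : frontier D ⊆ unionOfCircles S
  sided : ∀ c ∈ S, D ⊆ Metric.ball c.center c.radius ∨
    D ⊆ (Metric.closedBall c.center c.radius)ᶜ
  crossing : ∀ c ∈ S, ∀ c' ∈ S, c ≠ c' → ∀ x ∈ c.carrier, x ∈ c'.carrier →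
    c.radius ≠ c'.radius ∧ cross (x - c.center) (x - c'.center) ≠ 0 ∧
      (x - c.center) 0 * (x - c.center) 1 * ((x - c'.center) 0 * (x - c'.center) 1) ≤ 0

lemma PlaneCircle.isClosed_carrier (c : PlaneCircle) : IsClosed c.carrier := Metric.isClosed_sphere

lemma isClosed_unionOfCircles {S : Set PlaneCircle} (h : S.Finite) :
    IsClosed (unionOfCircles S) :=
  h.isClosed_biUnion fun c _ => c.isClosed_carrier

lemma mem_unionOfCircles {S : Set PlaneCircle} {x : Plane} :
    x ∈ unionOfCircles S ↔ ∃ c ∈ S, x ∈ c.carrier := by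
  simp [unionOfCircles]

lemma frontier_connectedComponentIn_subset {F : Set Plane} (hF : IsOpen F) (x : Plane) :
    frontier (connectedComponentIn F x) ⊆ Fᶜ := by
  intro y hy hyF
  rw [(hF.connectedComponentIn).frontier_eq] at hy
  obtain ⟨z, hz, hz'⟩ := mem_closure_iff.1 hy.1 _ hF.connectedComponentIn
    (mem_connectedComponentIn hyF)
  apply hy.2
  rw [connectedComponentIn_eq hz', ← connectedComponentIn_eq hz]
  exact mem_connectedComponentIn hyF

lemma WellPlaced.base {S : Set PlaneCircle} {D : Set Plane} (finite : S.Finite)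
    (disjoint : S.PairwiseDisjoint PlaneCircle.carrier) (region : IsBoundedRegion S D) :
    WellPlaced S D := by
  obtain ⟨-, x, -, rfl⟩ := region
  have hF : IsOpen (unionOfCircles S)ᶜ := (isClosed_unionOfCircles finite).isOpen_compl
  refine ⟨finite, hF.connectedComponentIn, ?_, fun c hc => ?_, fun c hc c' hc' hne x hx hx' => ?_⟩
  · simpa using frontier_connectedComponentIn_subset hF x
  · refine isPreconnected_connectedComponentIn.subset_or_subset Metric.isOpen_ball
      Metric.isClosed_closedBall.isOpen_compl
      (disjoint_compl_right.mono_right (compl_subset_compl.2 Metric.ball_subset_closedBall)) ?_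
    intro y hy
    have hy' : y ∉ c.carrier := fun h =>
      connectedComponentIn_subset _ _ hy (mem_unionOfCircles.2 ⟨c, hc, h⟩)
    rw [PlaneCircle.carrier, Metric.mem_sphere] at hy'
    rw [mem_union, Metric.mem_ball, mem_compl_iff, Metric.mem_closedBall, not_le]
    exact lt_or_gt_of_ne hy'
  · exact absurd hx' (disjoint_left.1 (disjoint hc hc' hne) hx)

lemma PlaneCircle.mem_carrier {c : PlaneCircle} {x : Plane} :
    x ∈ c.carrier ↔ ‖x - c.center‖ = c.radius := by
  rw [PlaneCircle.carrier, mem_sphere_iff_norm]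

lemma PlaneCircle.power_eq_zero {c : PlaneCircle} {p x : Plane} (hp : p ∈ c.carrier) :
    power (p - c.center) (x - p) = 0 ↔ x ∈ c.carrier := by
  rw [power_sub, mem_carrier.1 hp, mem_carrier, sub_eq_zero,
    sq_eq_sq₀ (norm_nonneg _) c.radius_pos.le]

/-- A small circle centered on a circle has with it the relation demanded in `WellPlaced`, and small
circles centered elsewhere do not meet it. -/
lemma eventually_crossing (c : PlaneCircle) (p : Plane) : ∀ᶠ r in 𝓝[>] (0 : ℝ), ∀ x : Plane,
    ‖x - p‖ = r → x ∈ c.carrier → c.radius ≠ r ∧ cross (x - c.center) (x - p) ≠ 0 ∧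
      (x - c.center) 0 * (x - c.center) 1 * ((x - p) 0 * (x - p) 1) ≤ 0 := by
  by_cases hp : p ∈ c.carrier
  · have hN : p - c.center ≠ 0 := norm_pos_iff.1 (by
      rw [PlaneCircle.mem_carrier.1 hp]; exact c.radius_pos)
    filter_upwards [eventually_normals _ hN] with r ⟨hr, h⟩ x hx hxc
    rw [PlaneCircle.mem_carrier.1 hp] at hr
    have := h (x - p) hx ((PlaneCircle.power_eq_zero hp).2 hxc)
    rw [show p - c.center + (x - p) = x - c.center by abel] at this
    exact ⟨hr.ne', this⟩
  · obtain ⟨ε, hε, hb⟩ := Metric.isOpen_iff.1 c.isClosed_carrier.isOpen_compl p hp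
    filter_upwards [nhdsWithin_le_nhds (eventually_lt_nhds hε)] with r hr x hx hxc
    exact absurd hxc (hb (by rwa [mem_ball_iff_norm, hx]))

/-- Every new crossing lies on the new circle, so `eventually_crossing` for each of the finitely
many old circles suffices. -/
lemma WellPlaced.eventually_step {S : Set PlaneCircle} {D : Set Plane} (h : WellPlaced S D)
    (p : Plane) : ∀ᶠ r in 𝓝[>] (0 : ℝ), ∀ hr : 0 < r,
      WellPlaced (insert ⟨p, r, hr⟩ S) (D \ Metric.closedBall p r) := by
  have hall := (eventually_all_finite h.finite).2 fun c _ => eventually_crossing c p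
  filter_upwards [hall] with r hr hr0
  refine ⟨h.finite.insert _, h.isOpen.sdiff Metric.isClosed_closedBall, ?_, ?_, ?_⟩
  · intro x hx
    rw [sdiff_eq] at hx
    rcases frontier_inter_subset _ _ hx with hx | hx
    · obtain ⟨c, hc, hxc⟩ := mem_unionOfCircles.1 (h.frontier_subset hx.1)
      exact mem_unionOfCircles.2 ⟨c, mem_insert_of_mem _ hc, hxc⟩
    · rw [frontier_compl] at hx
      exact mem_unionOfCircles.2 ⟨_, mem_insert _ _, Metric.frontier_closedBall_subset_sphere hx.2⟩
  · rintro c (rfl | hc)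
    · exact Or.inr fun x hx => hx.2
    · exact (h.sided c hc).imp sdiff_subset.trans sdiff_subset.trans
  · rintro c (rfl | hc) c' (rfl | hc') hne x hx hx'
    · exact absurd rfl hne
    · have hxr : ‖x - p‖ = r := (PlaneCircle.mem_carrier (c := ⟨p, r, hr0⟩)).1 hx
      obtain ⟨h₁, h₂, h₃⟩ := hr c' hc' x hxr hx'
      refine ⟨h₁.symm, ?_, ?_⟩ <;> dsimp only
      · rw [cross_swap]; exact neg_ne_zero.2 h₂
      · rw [mul_comm]; exact h₃
    · have hxr : ‖x - p‖ = r := (PlaneCircle.mem_carrier (c := ⟨p, r, hr0⟩)).1 hx'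
      have := hr c hc x hxr hx
      dsimp only
      exact this
    · exact h.crossing c hc c' hc' hne x hx hx'

/-! ### Double points -/

lemma WellPlaced.exists_sign {S : Set PlaneCircle} {D : Set Plane} (h : WellPlaced S D)
    {c : PlaneCircle} (hc : c ∈ S) {p : Plane} (hp : p ∈ c.carrier) :
    ∃ σ : ℝ, σ * σ = 1 ∧ ∀ m, p + m ∈ D → 0 < σ * power (p - c.center) m := by
  have key : ∀ m, power (p - c.center) m = ‖p + m - c.center‖ ^ 2 - c.radius ^ 2 := fun m => by
    have := power_sub p c.center (p + m)
    rwa [add_sub_cancel_left, PlaneCircle.mem_carrier.1 hp] at this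
  rcases h.sided c hc with hs | hs
  · refine ⟨-1, by norm_num, fun m hm => ?_⟩
    have := mem_ball_iff_norm.1 (hs hm)
    have : ‖p + m - c.center‖ ^ 2 < c.radius ^ 2 := by gcongr
    rw [key]; linarith
  · refine ⟨1, by norm_num, fun m hm => ?_⟩
    have := hs hm
    rw [mem_compl_iff, mem_closedBall_iff_norm, not_le] at this
    have hr := c.radius_pos
    have : c.radius ^ 2 < ‖p + m - c.center‖ ^ 2 := by gcongr
    rw [key]; linarith

/-- The finitely many circles not through `p` keep a positive distance from it, so near `p` the
frontier lies on `c₁` and `c₂` only. -/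
lemma WellPlaced.exists_isSector {S : Set PlaneCircle} {D : Set Plane} (h : WellPlaced S D)
    {p : Plane} {c₁ c₂ : PlaneCircle} (hp : IsDoublePoint S D p c₁ c₂) :
    ∃ σ₁ σ₂ ε, IsSector D p (p - c₁.center) (p - c₂.center) σ₁ σ₂ ε := by
  obtain ⟨σ₁, s₁, hσ₁⟩ := h.exists_sign hp.mem₁ hp.on₁
  obtain ⟨σ₂, s₂, hσ₂⟩ := h.exists_sign hp.mem₂ hp.on₂
  have hcl : IsClosed (unionOfCircles (S \ {c₁, c₂})) :=
    isClosed_unionOfCircles (h.finite.subset sdiff_subset)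
  have hpn : p ∈ (unionOfCircles (S \ {c₁, c₂}))ᶜ := by
    intro hmem
    obtain ⟨c, ⟨hc, hc'⟩, hpc⟩ := mem_unionOfCircles.1 hmem
    exact hc' (hp.only c hc hpc)
  obtain ⟨ε, hε, hb⟩ := Metric.isOpen_iff.1 hcl.isOpen_compl p hpn
  obtain ⟨ε', hε'⟩ := _root_.exists_isSector
    (h.crossing c₁ hp.mem₁ c₂ hp.mem₂ hp.ne p hp.on₁ hp.on₂).2.1 s₁ s₂ hε h.isOpen hp.mem_closure
    (fun m hm => ⟨hσ₁ m hm, hσ₂ m hm⟩) (fun m hm hmε => by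
      obtain ⟨c, hc, hmc⟩ := mem_unionOfCircles.1 (h.frontier_subset hm)
      have hc12 : c = c₁ ∨ c = c₂ := by
        by_contra hcon
        exact hb (by rwa [mem_ball_iff_norm, add_sub_cancel_left])
          (mem_unionOfCircles.2 ⟨c, ⟨hc, hcon⟩, hmc⟩)
      rw [← add_sub_cancel_left p m]
      rcases hc12 with rfl | rfl
      · exact Or.inl ((PlaneCircle.power_eq_zero hp.on₁).2 hmc)
      · exact Or.inr ((PlaneCircle.power_eq_zero hp.on₂).2 hmc))
  exact ⟨σ₁, σ₂, ε', hε'⟩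

/-- The canonical angle segments at a double point do not have both coordinates of equal signs, nor
both of opposite signs. -/
lemma WellPlaced.segments_mul_nonpos {S : Set PlaneCircle} {D : Set Plane} (h : WellPlaced S D)
    {p v w : Plane} {c₁ c₂ : PlaneCircle} (hp : IsDoublePoint S D p c₁ c₂)
    (hv : inner ℝ (p - c₁.center) v = 0) (hw : inner ℝ (p - c₂.center) w = 0) :
    (v 0 * w 0) * (v 1 * w 1) ≤ 0 := by
  obtain ⟨-, hcr, hle⟩ := h.crossing c₁ hp.mem₁ c₂ hp.mem₂ hp.ne p hp.on₁ hp.on₂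
  set n := p - c₁.center
  set n' := p - c₂.center
  have hn : 0 < n 0 ^ 2 + n 1 ^ 2 := by
    rw [← Plane.norm_sq_eq, PlaneCircle.mem_carrier.1 hp.on₁]
    exact pow_pos c₁.radius_pos 2
  have hn' : 0 < n' 0 ^ 2 + n' 1 ^ 2 := by
    rw [← Plane.norm_sq_eq, PlaneCircle.mem_carrier.1 hp.on₂]
    exact pow_pos c₂.radius_pos 2
  -- A tangent vector has coordinate product of sign opposite to that of the normal, so the sign
  -- condition passes from normals to segments.
  have tangent : ∀ n v : Plane, inner ℝ n v = 0 →
      (n 0 ^ 2 + n 1 ^ 2) * (v 0 * v 1) = -(v 0 ^ 2 + v 1 ^ 2) * (n 0 * n 1) := by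
    intro n v h
    rw [Plane.inner_eq] at h
    linear_combination (n 0 * v 1 + n 1 * v 0) * h
  have e := tangent n v hv
  have e' := tangent n' w hw
  have : (n 0 ^ 2 + n 1 ^ 2) * (n' 0 ^ 2 + n' 1 ^ 2) * ((v 0 * w 0) * (v 1 * w 1)) =
      (v 0 ^ 2 + v 1 ^ 2) * (w 0 ^ 2 + w 1 ^ 2) * (n 0 * n 1 * (n' 0 * n' 1)) := by
    linear_combination (n' 0 ^ 2 + n' 1 ^ 2) * (w 0 * w 1) * e -
      (v 0 ^ 2 + v 1 ^ 2) * (n 0 * n 1) * e'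
  by_contra! hpos
  have h1 := mul_pos (mul_pos hn hn') hpos
  rw [this] at h1
  have h2 : 0 ≤ (v 0 ^ 2 + v 1 ^ 2) * (w 0 ^ 2 + w 1 ^ 2) := by positivity
  nlinarith

/-! ### The points in which a small circle meets the boundary of a sector -/

lemma eventually_lt_nhdsGT {a : ℝ} (ha : 0 < a) : ∀ᶠ r in 𝓝[>] (0 : ℝ), r < a :=
  nhdsWithin_le_nhds (eventually_lt_nhds ha)

lemma abs_eq_one_of_mul_self {σ : ℝ} (h : σ * σ = 1) : |σ| = 1 := by
  rw [← sq_eq_sq₀ (abs_nonneg _) zero_le_one, sq_abs]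
  linarith [sq σ]

lemma ne_zero_left_of_cross {n₁ n₂ : Plane} (h : cross n₁ n₂ ≠ 0) : n₁ ≠ 0 := by
  rintro rfl
  simp [cross] at h

lemma ne_zero_right_of_cross {n₁ n₂ : Plane} (h : cross n₁ n₂ ≠ 0) : n₂ ≠ 0 := by
  rintro rfl
  simp [cross] at h

lemma abs_cross_le (x y : Plane) : |cross x y| ≤ ‖x‖ * ‖y‖ := by
  rw [← sq_le_sq₀ (abs_nonneg _) (by positivity), sq_abs, mul_pow, Plane.norm_sq_eq,
    Plane.norm_sq_eq, cross]
  nlinarith [sq_nonneg (x 0 * y 0 + x 1 * y 1)]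

/-- A canonical angle segment of the first circle of a sector points to the side of the second one
on which the sector lies. -/
lemma IsSector.eventually_canonical {D : Set Plane} {p n₁ n₂ : Plane} {σ₁ σ₂ ε : ℝ}
    (h : IsSector D p n₁ n₂ σ₁ σ₂ ε) : ∀ᶠ r in 𝓝[>] (0 : ℝ), ∀ v : Plane,
      inner ℝ n₁ v = 0 → ‖v‖ = r →
      Metric.infDist (p + v) (D ∩ Metric.sphere p r) <
        Metric.infDist (p - v) (D ∩ Metric.sphere p r) → 0 < σ₂ * inner ℝ n₂ v := by
  have hR₁ : 0 < ‖n₁‖ := norm_pos_iff.2 (ne_zero_left_of_cross h.cross_ne)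
  have hR₂ : 0 < ‖n₂‖ := norm_pos_iff.2 (ne_zero_right_of_cross h.cross_ne)
  have hΔ : 0 < |cross n₁ n₂| := abs_pos.2 h.cross_ne
  -- `d` is the sine of the angle between the two circles.
  obtain ⟨d, hd⟩ : ∃ d, d = |cross n₁ n₂| / (‖n₁‖ * ‖n₂‖) := ⟨_, rfl⟩
  have hd0 : 0 < d := by rw [hd]; positivity
  have hd1 : d ≤ 1 := by
    rw [hd, div_le_one (by positivity)]
    exact abs_cross_le _ _
  have hdΔ : d * (‖n₁‖ * ‖n₂‖) = |cross n₁ n₂| := by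
    rw [hd]; field_simp
  obtain ⟨c, hc⟩ : ∃ c, c = √(1 - (d / 2) ^ 2) := ⟨_, rfl⟩
  have hc2 : c ^ 2 = 1 - (d / 2) ^ 2 := by
    rw [hc, Real.sq_sqrt]; nlinarith
  have hc0 : 0 ≤ c := by rw [hc]; positivity
  have hc1 : c ≤ 1 := by nlinarith
  have hc8 : 4 / 5 ≤ c := by nlinarith
  have a₁ := abs_eq_one_of_mul_self h.sign₁
  have a₂ := abs_eq_one_of_mul_self h.sign₂
  have l₁ := (abs_le.1 a₁.le).1
  have l₂ := (abs_le.1 a₂.le).1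
  filter_upwards [self_mem_nhdsWithin, eventually_lt_nhdsGT h.pos,
    eventually_lt_nhdsGT (show 0 < d * ‖n₁‖ by positivity),
    eventually_lt_nhdsGT (show 0 < 3 / 5 * d * ‖n₂‖ by positivity)]
    with r (hr : 0 < r) hrε hr₁ hr₂ v hv hvr hlt
  by_contra! hneg
  set β : ℝ := inner ℝ n₂ v with hβ
  have hβ2 : β ^ 2 * ‖n₁‖ ^ 2 = cross n₁ n₂ ^ 2 * r ^ 2 := by
    rw [hβ, ← hvr, Plane.norm_sq_eq, Plane.norm_sq_eq, Plane.inner_eq, cross]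
    rw [Plane.inner_eq] at hv
    linear_combination ((n₂ 0 ^ 2 - n₂ 1 ^ 2) * (n₁ 0 * v 0 - n₁ 1 * v 1) +
      2 * n₂ 0 * n₂ 1 * (n₁ 0 * v 1 + n₁ 1 * v 0)) * hv
  have hβabs : |β| = r * d * ‖n₂‖ := by
    rw [← mul_left_inj' hR₁.ne', ← sq_eq_sq₀ (by positivity) (by positivity), mul_pow, sq_abs, hβ2,
      ← sq_abs (cross n₁ n₂), ← hdΔ]
    ring
  have hσβ : σ₂ * β = -(r * d * ‖n₂‖) := by
    rw [← hβabs, ← one_mul |β|, ← a₂, ← abs_mul, abs_of_nonpos hneg, neg_neg]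
  -- a point of the arc near `p - v`
  set m : Plane := (-c) • v + (d / 2 * r * σ₁ / ‖n₁‖) • n₁ with hm
  have hinn₁ : inner ℝ n₁ m = d / 2 * r * σ₁ * ‖n₁‖ := by
    rw [hm, inner_add_right, inner_smul_right, inner_smul_right, hv, real_inner_self_eq_norm_sq]
    field_simp
    ring
  have hinn₂ : inner ℝ n₂ m = -c * β + d / 2 * r * σ₁ / ‖n₁‖ * inner ℝ n₂ n₁ := by
    rw [hm, inner_add_right, inner_smul_right, inner_smul_right]
  have hnorm : ∀ a b : ℝ, ‖a • v + (b * r * σ₁ / ‖n₁‖) • n₁‖ ^ 2 = (a ^ 2 + b ^ 2) * r ^ 2 := by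
    intro a b
    rw [norm_add_sq_real, inner_smul_left, inner_smul_right, real_inner_comm, hv, norm_smul,
      norm_smul, mul_pow, mul_pow, hvr]
    simp only [Real.norm_eq_abs, sq_abs]
    field_simp
    linear_combination r * ‖n₁‖ * b ^ 2 * h.sign₁
  have hmr : ‖m‖ = r := by
    rw [← sq_eq_sq₀ (norm_nonneg _) hr.le, hm, hnorm, neg_sq, hc2]
    ring
  have hmD : p + m ∈ D := by
    rw [h.mem_iff m (by rwa [hmr]), power, power, hmr, hinn₁, hinn₂]
    constructor
    · have e : σ₁ * (r ^ 2 + 2 * (d / 2 * r * σ₁ * ‖n₁‖)) = r * (σ₁ * r + d * ‖n₁‖) := by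
        linear_combination d * r * ‖n₁‖ * h.sign₁
      rw [e]
      refine mul_pos hr ?_
      linarith [mul_le_mul_of_nonneg_right l₁ hr.le]
    · have e : σ₂ * (r ^ 2 + 2 * (-c * β + d / 2 * r * σ₁ / ‖n₁‖ * inner ℝ n₂ n₁)) =
          r * (σ₂ * r + 2 * c * d * ‖n₂‖ + d * (σ₁ * σ₂ * (inner ℝ n₂ n₁ / ‖n₁‖))) := by
        field_simp
        linear_combination (-2) * c * ‖n₁‖ * hσβ
      rw [e]
      refine mul_pos hr ?_
      have hle : -‖n₂‖ ≤ σ₁ * σ₂ * (inner ℝ n₂ n₁ / ‖n₁‖) := by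
        refine (abs_le.1 ?_).1
        rw [abs_mul, abs_mul, a₁, a₂, one_mul, one_mul, abs_div, abs_norm, div_le_iff₀ hR₁]
        exact abs_real_inner_le_norm _ _
      have h1 : d * (-‖n₂‖) ≤ d * (σ₁ * σ₂ * (inner ℝ n₂ n₁ / ‖n₁‖)) := by gcongr
      have h2 : 2 * (4 / 5) * d * ‖n₂‖ ≤ 2 * c * d * ‖n₂‖ := by gcongr
      linarith [mul_le_mul_of_nonneg_right l₂ hr.le]
  have hmem : p + m ∈ D ∩ Metric.sphere p r :=
    ⟨hmD, by rw [mem_sphere_iff_norm, add_sub_cancel_left, hmr]⟩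
  have upper : Metric.infDist (p - v) (D ∩ Metric.sphere p r) ≤ 3 / 5 * d * r := by
    refine (Metric.infDist_le_dist_of_mem hmem).trans ?_
    rw [dist_comm, dist_eq_norm, show p + m - (p - v) = (1 - c) • v + (d / 2 * r * σ₁ / ‖n₁‖) • n₁ by
      rw [hm, sub_smul, one_smul, neg_smul]; abel, ← sq_le_sq₀ (norm_nonneg _) (by positivity), hnorm]
    have hcc : c ^ 2 ≤ c := by rw [sq]; exact mul_le_of_le_one_left hc0 hc1
    have h1 : 1 - c ≤ (d / 2) ^ 2 := by linarith
    have h2 : (1 - c) ^ 2 ≤ ((d / 2) ^ 2) ^ 2 := by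
      have : 0 ≤ 1 - c := by linarith
      gcongr
    have hdd : d ^ 2 ≤ 1 := pow_le_one₀ hd0.le hd1
    have h3 : (1 - c) ^ 2 + (d / 2) ^ 2 ≤ (3 / 5 * d) ^ 2 := by
      refine (add_le_add_left h2 _).trans ?_
      have : d ^ 2 * d ^ 2 ≤ d ^ 2 := mul_le_of_le_one_left (sq_nonneg d) hdd
      linarith [sq_nonneg d]
    rw [mul_pow _ r]
    exact mul_le_mul_of_nonneg_right h3 (sq_nonneg r)
  have lower : 7 / 10 * d * r ≤ Metric.infDist (p + v) (D ∩ Metric.sphere p r) := by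
    refine (Metric.le_infDist ⟨_, hmem⟩).2 ?_
    rintro y ⟨hyD, hy⟩
    rw [mem_sphere_iff_norm] at hy
    have hy' : p + (y - p) ∈ D := by simpa using hyD
    have hpow := ((h.mem_iff (y - p) (by rwa [hy])).1 hy').2
    rw [power, hy] at hpow
    have hdist : σ₂ * inner ℝ n₂ (y - p) - σ₂ * β ≤ ‖n₂‖ * dist (p + v) y := by
      rw [dist_comm, dist_eq_norm, ← mul_sub, hβ, ← inner_sub_right]
      refine (le_abs_self _).trans ?_
      rw [abs_mul, a₂, one_mul, sub_sub]
      exact abs_real_inner_le_norm _ _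
    have : ‖n₂‖ * (7 / 10 * d * r) ≤ ‖n₂‖ * dist (p + v) y := by
      rw [hσβ] at hdist
      have h1 : σ₂ * r ^ 2 ≤ r ^ 2 :=
        mul_le_of_le_one_left (sq_nonneg r) (abs_le.1 a₂.le).2
      have h2 : r * r ≤ r * (3 / 5 * d * ‖n₂‖) := mul_le_mul_of_nonneg_left hr₂.le hr.le
      linarith
    exact le_of_mul_le_mul_left this hR₂
  linarith [mul_pos hd0 hr]

/-- A small circle around the apex of a sector meets each of the two sides of the sector. -/
lemma eventually_exists_corner {n₁ n₂ : Plane} {σ : ℝ} (h : cross n₁ n₂ ≠ 0) (hσ : σ * σ = 1) :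
    ∀ᶠ r in 𝓝[>] (0 : ℝ), ∃ m : Plane, ‖m‖ = r ∧ power n₁ m = 0 ∧ 0 ≤ σ * power n₂ m := by
  have hR₁ : 0 < ‖n₁‖ := norm_pos_iff.2 (ne_zero_left_of_cross h)
  have hΔ : 0 < |cross n₁ n₂| := abs_pos.2 h
  have a := abs_eq_one_of_mul_self hσ
  obtain ⟨τ, hτ, hτΔ⟩ : ∃ τ : ℝ, τ * τ = 1 ∧ σ * (τ * cross n₁ n₂) = |cross n₁ n₂| := by
    rcases abs_cases (cross n₁ n₂) with ⟨e, _⟩ | ⟨e, _⟩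
    · exact ⟨σ, hσ, by rw [e]; linear_combination cross n₁ n₂ * hσ⟩
    · exact ⟨-σ, by linear_combination hσ, by rw [e]; linear_combination -cross n₁ n₂ * hσ⟩
  filter_upwards [self_mem_nhdsWithin, eventually_lt_nhdsGT hR₁,
    eventually_lt_nhdsGT (show 0 < |cross n₁ n₂| / (‖n₁‖ + ‖n₂‖) by positivity)]
    with r (hr : 0 < r) hr₁ hr₂
  obtain ⟨u, hu⟩ : ∃ u, u = √(1 - (r / (2 * ‖n₁‖)) ^ 2) := ⟨_, rfl⟩
  have hq : r / (2 * ‖n₁‖) < 1 / 2 := by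
    rw [div_lt_iff₀ (by positivity)]; linarith
  have hq0 : 0 < r / (2 * ‖n₁‖) := by positivity
  have hu2 : u ^ 2 = 1 - (r / (2 * ‖n₁‖)) ^ 2 := by
    rw [hu, Real.sq_sqrt]; nlinarith
  have hu0 : 0 ≤ u := by rw [hu]; positivity
  have huh : 1 / 2 ≤ u := by nlinarith
  set J : Plane := !₂[-n₁ 1, n₁ 0] with hJ
  have J0 : J 0 = -n₁ 1 := rfl
  have J1 : J 1 = n₁ 0 := rfl
  have i11 : inner ℝ n₁ J = 0 := by rw [Plane.inner_eq, J0, J1]; ring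
  have i2 : inner ℝ n₂ J = cross n₁ n₂ := by rw [Plane.inner_eq, J0, J1, cross]; ring
  have nJ : ‖J‖ = ‖n₁‖ := by
    rw [← sq_eq_sq₀ (norm_nonneg _) (norm_nonneg _), Plane.norm_sq_eq, Plane.norm_sq_eq, J0, J1]
    ring
  -- The normal component is forced by `power n₁ m = 0`, the tangential one by `‖m‖ = r`; `τ`
  -- selects the solution on the correct side of the second circle.
  set m : Plane := (-(r ^ 2 / (2 * ‖n₁‖ ^ 2))) • n₁ + (τ * r * u / ‖n₁‖) • J with hm
  have hmr : ‖m‖ = r := by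
    rw [← sq_eq_sq₀ (norm_nonneg _) hr.le, hm, norm_add_sq_real, inner_smul_left, inner_smul_right,
      i11, norm_smul, norm_smul, mul_pow, mul_pow, nJ]
    simp only [Real.norm_eq_abs, sq_abs]
    have e : (τ * r * u / ‖n₁‖) ^ 2 = r ^ 2 * (1 - (r / (2 * ‖n₁‖)) ^ 2) / ‖n₁‖ ^ 2 := by
      rw [← hu2]
      field_simp
      linear_combination hτ
    rw [e]
    field_simp
    ring
  refine ⟨m, hmr, ?_, ?_⟩
  · rw [power, hmr, hm, inner_add_right, inner_smul_right, inner_smul_right, i11,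
      real_inner_self_eq_norm_sq]
    field_simp
    ring
  · have e : σ * power n₂ m = r * (σ * r - r / ‖n₁‖ * (σ * (inner ℝ n₂ n₁ / ‖n₁‖)) +
        2 * u * |cross n₁ n₂| / ‖n₁‖) := by
      rw [power, hmr, hm, inner_add_right, inner_smul_right, inner_smul_right, i2, ← hτΔ]
      field_simp
      ring
    rw [e]
    refine mul_nonneg hr.le ?_
    have hle : σ * (inner ℝ n₂ n₁ / ‖n₁‖) ≤ ‖n₂‖ := by
      refine (le_abs_self _).trans ?_
      rw [abs_mul, a, one_mul, abs_div, abs_norm, div_le_iff₀ hR₁]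
      exact abs_real_inner_le_norm _ _
    have h1 : r / ‖n₁‖ * (σ * (inner ℝ n₂ n₁ / ‖n₁‖)) ≤ r / ‖n₁‖ * ‖n₂‖ := by gcongr
    have h2 : 2 * (1 / 2) * |cross n₁ n₂| / ‖n₁‖ ≤ 2 * u * |cross n₁ n₂| / ‖n₁‖ := by gcongr
    have h3 : r + r / ‖n₁‖ * ‖n₂‖ ≤ 2 * (1 / 2) * |cross n₁ n₂| / ‖n₁‖ := by
      rw [lt_div_iff₀ (by positivity)] at hr₂
      rw [le_div_iff₀ hR₁]
      field_simp
      linarith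
    nlinarith [(abs_le.1 a.le).1]

/-- Two distinct circles through `p` have no common point on a small circle around `p`. -/
lemma eventually_power_ne {n n' : Plane} (h : n ≠ n') : ∀ᶠ r in 𝓝[>] (0 : ℝ), ∀ m : Plane,
    ‖m‖ = r → power n m = 0 → power n' m ≠ 0 := by
  have hd : 0 < ‖n - n'‖ := norm_pos_iff.2 (sub_ne_zero.2 h)
  have hsmall : ∀ᶠ r in 𝓝[>] (0 : ℝ), cross n (n - n') ≠ 0 →
      r < |2 * cross n (n - n') / ‖n - n'‖| := by
    refine (eventually_lt_abs (2 * cross n (n - n') / ‖n - n'‖)).mono fun r hr hc => hr ?_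
    positivity
  filter_upwards [self_mem_nhdsWithin, hsmall] with r (hr : 0 < r) hlt m hm h₁ h₂
  have hr2 : r ^ 2 = m 0 ^ 2 + m 1 ^ 2 := by rw [← hm, Plane.norm_sq_eq]
  have hdn := Plane.norm_sq_eq (n - n')
  simp only [power, Plane.inner_eq, hm] at h₁ h₂
  have hdm : (n - n') 0 * m 0 + (n - n') 1 * m 1 = 0 := by
    simp only [PiLp.sub_apply]
    linarith
  -- A common point lies on the radical axis, orthogonal to `n - n'`. This fixes its distance from
  -- `p` to a single value, excluded by `hsmall`, or to zero if the circles are tangent.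
  have key : r ^ 2 * (r ^ 2 * ‖n - n'‖ ^ 2) = r ^ 2 * (2 * cross n (n - n')) ^ 2 := by
    have e : (n 0 * m 0 + n 1 * m 1) ^ 2 * ‖n - n'‖ ^ 2 = cross n (n - n') ^ 2 * r ^ 2 := by
      rw [hdn, hr2, cross]
      generalize (n - n') 0 = a at *
      generalize (n - n') 1 = b at *
      linear_combination ((n 0 ^ 2 - n 1 ^ 2) * (a * m 0 - b * m 1) +
        2 * n 0 * n 1 * (a * m 1 + b * m 0)) * hdm
    have e2 : n 0 * m 0 + n 1 * m 1 = -(r ^ 2) / 2 := by linarith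
    rw [e2] at e
    linear_combination 4 * e
  have key2 := mul_left_cancel₀ (pow_ne_zero 2 hr.ne') key
  have hc : cross n (n - n') ≠ 0 := by
    intro h0
    rw [h0] at key2
    have : 0 < r ^ 2 * ‖n - n'‖ ^ 2 := by positivity
    simp at key2
    rcases key2 with h | h
    · exact hr.ne' h
    · exact hd.ne' (by rw [h, norm_zero])
  have h3 := hlt hc
  rw [abs_div, abs_norm, lt_div_iff₀ hd, ← sq_lt_sq₀ (by positivity) (by positivity), sq_abs, mul_pow,
    key2] at h3
  exact lt_irrefl _ h3

lemma power_single (n : Plane) (i : Fin 2) (t : ℝ) :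
    power n (EuclideanSpace.single i t) = t * (t + 2 * n i) := by
  rw [power, PiLp.norm_single, Real.norm_eq_abs, sq_abs,
    EuclideanSpace.inner_single_right]
  simp
  ring

/-- The circles of a sector do not contain the poles of a small circle around the apex, unless the
apex is a pole of them. -/
lemma eventually_power_single_ne {n : Plane} {i : Fin 2} (h : n i ≠ 0) :
    ∀ᶠ r in 𝓝[>] (0 : ℝ), ∀ t, |t| = r → power n (EuclideanSpace.single i t) ≠ 0 := by
  filter_upwards [self_mem_nhdsWithin, eventually_lt_nhdsGT (abs_pos.2 h)]
    with r (hr : 0 < r) hlt t ht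
  rw [power_single]
  refine mul_ne_zero (by rintro rfl; simp at ht; exact hr.ne ht) fun h0 => ?_
  have : t = -(2 * n i) := by linarith
  rw [this, abs_neg, abs_mul, abs_two] at ht
  linarith [abs_nonneg (n i)]

/-- If a sector opens in the direction of a coordinate axis, a pole of a small circle around the
apex lies in it. -/
lemma eventually_exists_pole {n₁ n₂ : Plane} {σ₁ σ₂ : ℝ} {i : Fin 2} (s₁ : σ₁ * σ₁ = 1)
    (s₂ : σ₂ * σ₂ = 1) (h : 0 < (σ₁ * n₁ i) * (σ₂ * n₂ i)) :
    ∀ᶠ r in 𝓝[>] (0 : ℝ), ∃ t, |t| = r ∧ 0 ≤ σ₁ * power n₁ (EuclideanSpace.single i t) ∧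
      0 ≤ σ₂ * power n₂ (EuclideanSpace.single i t) := by
  have aux : ∀ {σ n t : ℝ}, σ * σ = 1 → 0 < σ * n * t → |t| < |n| → 0 ≤ σ * (t * (t + 2 * n)) := by
    intro σ n t hs h hlt
    have a := abs_eq_one_of_mul_self hs
    have e : |σ * n * t| = |n| * |t| := by rw [abs_mul, abs_mul, a, one_mul]
    rw [abs_of_pos h] at e
    have e2 : |σ * t ^ 2| = |t| ^ 2 := by rw [abs_mul, a, one_mul, abs_pow]
    have := (abs_le.1 e2.le).1
    nlinarith [abs_nonneg t]
  have h₁ : σ₁ * n₁ i ≠ 0 := left_ne_zero_of_mul h.ne'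
  have h₂ : σ₂ * n₂ i ≠ 0 := right_ne_zero_of_mul h.ne'
  filter_upwards [self_mem_nhdsWithin,
    eventually_lt_nhdsGT (abs_pos.2 (right_ne_zero_of_mul h₁)),
    eventually_lt_nhdsGT (abs_pos.2 (right_ne_zero_of_mul h₂))] with r (hr : 0 < r) hr₁ hr₂
  simp only [power_single]
  -- The pole to take is the one on the side given by the common sign of `σ₁ * n₁ i` and `σ₂ * n₂
  -- i`.
  rcases h₁.lt_or_gt with hneg | hpos
  · have hneg₂ : σ₂ * n₂ i < 0 := by
      by_contra! hle
      nlinarith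
    have ht : |(-r)| = r := by rw [abs_neg, abs_of_pos hr]
    exact ⟨-r, ht, aux s₁ (by nlinarith) (by rwa [ht]), aux s₂ (by nlinarith) (by rwa [ht])⟩
  · have hpos₂ : 0 < σ₂ * n₂ i := pos_of_mul_pos_right h hpos.le
    have ht : |r| = r := abs_of_pos hr
    exact ⟨r, ht, aux s₁ (by nlinarith) (by rwa [ht]), aux s₂ (by nlinarith) (by rwa [ht])⟩

/-! ### The labels of a split graph -/

namespace VDigraph

/-- Preserving strict order of real labels preserves equality too, so the labels of `G` factor
through those of `H`. -/
lemma Iso.encard_range_label_le {G H : VDigraph} (f : Iso G H) :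
    (range G.label).encard ≤ (range H.label).encard := by
  have hfac : Function.FactorsThrough (G.label ∘ f.toV.symm) H.label := by
    intro u u' h
    have e₁ := f.label_lt_iff (f.toV.symm u) (f.toV.symm u')
    have e₂ := f.label_lt_iff (f.toV.symm u') (f.toV.symm u)
    simp only [Equiv.apply_symm_apply, h, lt_irrefl, iff_false, not_lt] at e₁ e₂
    exact le_antisymm e₂ e₁
  obtain ⟨g, hg⟩ := (Function.factorsThrough_iff _).1 hfac
  have : range G.label = g '' range H.label := by
    rw [← range_comp, ← hg, range_comp, f.toV.symm.surjective.range_eq, image_univ]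
  rw [this]
  exact encard_image_le _ _

lemma encard_insert_insert_le (s : Set ℝ) (a b : ℝ) :
    (insert a (insert b s)).encard ≤ s.encard + 2 := by
  refine (encard_insert_le _ _).trans ?_
  calc _ ≤ s.encard + 1 + 1 := by gcongr; exact encard_insert_le _ _
    _ = s.encard + 2 := by rw [add_assoc]; rfl

/-- The number of labels increases by at most two in a split, and by at most one if no other vertex
has the label of the vertex that is split. -/
lemma IsForwardSplit.encard_range_label_le {G H : VDigraph} {x : ℝ} (h : IsForwardSplit G H x) :
    (range H.label).encard ≤ (range G.label \ {x}).encard + 2 ∨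
      (∃ v w, v ≠ w ∧ G.label v = x ∧ G.label w = x) ∧
        (range H.label).encard ≤ (range G.label).encard + 2 := by
  obtain ⟨v₀, a, b, ha, hab, hb, hx, -, -, ⟨f⟩⟩ := h
  have hle := f.encard_range_label_le
  -- The old label `x` of `v₀` disappears unless another vertex carries it.
  by_cases hu : ∃ w, v₀ ≠ w ∧ G.label w = x
  · obtain ⟨w, hw, hwx⟩ := hu
    refine Or.inr ⟨⟨v₀, w, hw, hx, hwx⟩, hle.trans ((encard_le_encard ?_).trans
      (encard_insert_insert_le _ a b))⟩
    rintro _ ⟨v | k, rfl⟩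
    · by_cases hv : v = v₀
      · exact Or.inr (Or.inl (by simp [splitEnd, hv]))
      · exact Or.inr (Or.inr ⟨v, by simp [splitEnd, hv]⟩)
    · exact Or.inl rfl
  · push Not at hu
    refine Or.inl (hle.trans ((encard_le_encard ?_).trans (encard_insert_insert_le _ a b)))
    rintro _ ⟨v | k, rfl⟩
    · by_cases hv : v = v₀
      · exact Or.inr (Or.inl (by simp [splitEnd, hv]))
      · refine Or.inr (Or.inr ?_)
        have : (G.splitEnd v₀ a b ha hab hb).label (.inl v) = G.label v := by simp [splitEnd, hv]
        rw [this]
        exact ⟨⟨v, rfl⟩, hu v (Ne.symm hv)⟩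
    · exact Or.inl rfl

lemma range_reverse_label (G : VDigraph) : range G.reverse.label = Neg.neg '' range G.label :=
  range_comp Neg.neg G.label

lemma IsSplit.encard_range_label_le {G H : VDigraph} {x : ℝ} (h : IsSplit G H x) :
    (range H.label).encard ≤ (range G.label \ {x}).encard + 2 ∨
      (∃ v w, v ≠ w ∧ G.label v = x ∧ G.label w = x) ∧
        (range H.label).encard ≤ (range G.label).encard + 2 := by
  rcases h with h | h
  · exact h.encard_range_label_le
  · have hd : Neg.neg '' range G.label \ {-x} = Neg.neg '' (range G.label \ {x}) := by
      rw [image_sdiff neg_injective, image_singleton]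
    have := h.encard_range_label_le
    simp only [range_reverse_label, hd, neg_injective.encard_image] at this
    refine this.imp_right (And.imp_left ?_)
    rintro ⟨v, w, hvw, hv, hw⟩
    exact ⟨v, w, hvw, neg_injective hv, neg_injective hw⟩

end VDigraph

/-! ### The labels of Poincaré-Reeb graphs -/

/-- The points of the plane whose classes are the vertices of the Poincaré-Reeb graph. -/
def specialPoints (S : Set PlaneCircle) (i : Fin 2) : Set Plane :=
  {x | (∃ c ∈ S, c.IsPole i x) ∨
    ∃ c₁ ∈ S, ∃ c₂ ∈ S, c₁ ≠ c₂ ∧ x ∈ c₁.carrier ∧ x ∈ c₂.carrier}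

lemma specialPoints_mono {S S' : Set PlaneCircle} (h : S ⊆ S') (i : Fin 2) :
    specialPoints S i ⊆ specialPoints S' i := by
  rintro x (⟨c, hc, hx⟩ | ⟨c, hc, c', hc', hx⟩)
  · exact Or.inl ⟨c, h hc, hx⟩
  · exact Or.inr ⟨c, h hc, c', h hc', hx⟩

lemma exists_of_vertex {S : Set PlaneCircle} {D : Set Plane} {i : Fin 2}
    (v : (poincareReeb S D i).V) : ∃ x : closure D, (x : Plane) ∈ specialPoints S i ∧
      ReebSpace.mk (closure D) i x = v.1 ∧ (poincareReeb S D i).label v = (x : Plane) i := by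
  obtain ⟨v, x, rfl, hx⟩ := v
  exact ⟨x, hx, rfl, rfl⟩

/-- This reduces the comparison of the graphs to coordinates of finitely many points of the plane.
-/
lemma range_poincareReeb_label (S : Set PlaneCircle) (D : Set Plane) (i : Fin 2) :
    range (poincareReeb S D i).label = (fun x : Plane => x i) '' (closure D ∩ specialPoints S i) := by
  ext t
  constructor
  · rintro ⟨v, rfl⟩
    obtain ⟨x, hx, -, h⟩ := exists_of_vertex v
    exact ⟨x, ⟨x.2, hx⟩, h.symm⟩
  · rintro ⟨x, ⟨hxD, hx⟩, rfl⟩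
    exact ⟨⟨ReebSpace.mk (closure D) i ⟨x, hxD⟩, ⟨x, hxD⟩, rfl, hx⟩, rfl⟩

/-- Distinct vertices have distinct representatives, so at most one of those chosen is `p`. -/
lemma exists_specialPoint_ne {S : Set PlaneCircle} {D : Set Plane} {i : Fin 2} {t : ℝ}
    {v w : (poincareReeb S D i).V} (hvw : v ≠ w) (hv : (poincareReeb S D i).label v = t)
    (hw : (poincareReeb S D i).label w = t) (p : Plane) :
    ∃ x ∈ closure D ∩ specialPoints S i, x ≠ p ∧ x i = t := by
  obtain ⟨x, hx, hxv, hxl⟩ := exists_of_vertex v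
  obtain ⟨y, hy, hyw, hyl⟩ := exists_of_vertex w
  by_cases h : (x : Plane) = p
  · refine ⟨y, ⟨y.2, hy⟩, fun h' => hvw (Subtype.ext ?_), hyl ▸ hw⟩
    rw [← hxv, ← hyw, Subtype.ext (h.trans h'.symm)]
  · exact ⟨x, ⟨x.2, hx⟩, h, hxl ▸ hv⟩

lemma PlaneCircle.finite_inter {c c' : PlaneCircle} (h : c.center ≠ c'.center) :
    (c.carrier ∩ c'.carrier).Finite := by
  by_contra hinf
  obtain ⟨a, ha, b, hb, hab⟩ := Set.Infinite.nontrivial hinf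
  obtain ⟨x, hx, hx'⟩ := Set.Infinite.exists_notMem_finset hinf {a, b}
  have := EuclideanGeometry.eq_of_dist_eq_of_dist_eq_of_finrank_eq_two
    (V := Plane) (P := Plane) (by simp) h hab ha.1 hb.1 hx.1 ha.2 hb.2 hx.2
  simp only [Finset.mem_insert, Finset.mem_singleton] at hx'
  exact hx' this

lemma WellPlaced.finite_specialPoints {S : Set PlaneCircle} {D : Set Plane} (h : WellPlaced S D)
    (i : Fin 2) : (specialPoints S i).Finite := by
  have h₁ : (⋃ c ∈ S, {c.center + EuclideanSpace.single i c.radius,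
      c.center - EuclideanSpace.single i c.radius}).Finite :=
    h.finite.biUnion fun c _ => toFinite _
  have h₂ : (⋃ c ∈ S, ⋃ c' ∈ S, {x | c ≠ c' ∧ x ∈ c.carrier ∩ c'.carrier}).Finite := by
    refine h.finite.biUnion fun c hc => h.finite.biUnion fun c' hc' => ?_
    by_cases hcc : c.center = c'.center
    · convert finite_empty
      rw [eq_empty_iff_forall_notMem]
      rintro x ⟨hne, hx, hx'⟩
      apply (h.crossing c hc c' hc' hne x hx hx').2.1
      rw [hcc, cross]
      ring
    · exact (PlaneCircle.finite_inter hcc).subset fun x hx => hx.2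
  refine (h₁.union h₂).subset ?_
  rintro x (⟨c, hc, hx⟩ | ⟨c, hc, c', hc', hne, hx, hx'⟩)
  · exact Or.inl (mem_biUnion hc hx)
  · exact Or.inr (mem_biUnion hc (mem_biUnion hc' ⟨hne, hx, hx'⟩))

/-! ### The change of the labels at a double point -/

/-- The corners on the two circles through a double point have distinct coordinates. -/
lemma eventually_corners_ne {n₁ n₂ : Plane} (h : ‖n₁‖ ≠ ‖n₂‖) (i : Fin 2) :
    ∀ᶠ r in 𝓝[>] (0 : ℝ), ∀ m m' : Plane, ‖m‖ = r → ‖m'‖ = r → power n₁ m = 0 → power n₂ m' = 0 →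
      m i ≠ m' i := by
  have norm_flip : ∀ (x y : Plane), x i = y i → x i.rev = -y i.rev → ‖x‖ = ‖y‖ := by
    intro x y h₁ h₂
    rw [← sq_eq_sq₀ (norm_nonneg _) (norm_nonneg _), Plane.norm_sq_eq, Plane.norm_sq_eq]
    fin_cases i <;> simp_all
  -- The mirror image of `n₂` in the `i`-th axis. Corners with equal `i`-th coordinate coincide or
  -- are mirror images, so the first circle would share a corner with the second or with its
  -- reflection; both differ from it by the radius.
  obtain ⟨n, hn, hn'⟩ : ∃ n : Plane, n i = n₂ i ∧ n i.rev = -n₂ i.rev := by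
    fin_cases i
    · exact ⟨!₂[n₂ 0, -n₂ 1], rfl, rfl⟩
    · exact ⟨!₂[-n₂ 0, n₂ 1], rfl, rfl⟩
  have e₁ : n₁ ≠ n₂ := fun e => h (by rw [e])
  have e₂ : n₁ ≠ n := fun e => h (by rw [e, norm_flip n n₂ hn hn'])
  filter_upwards [eventually_power_ne e₁, eventually_power_ne e₂] with r h₁ h₂ m m' hm hm' hp hp' hi
  have hsq : m i.rev ^ 2 = m' i.rev ^ 2 := by
    have := Plane.norm_sq_eq m
    rw [hm, ← hm', Plane.norm_sq_eq] at this
    fin_cases i <;> simp_all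
  rcases sq_eq_sq_iff_eq_or_eq_neg.1 hsq with hj | hj
  · have : m = m' := by
      fin_cases i
      · exact Plane.ext_coord hi hj
      · exact Plane.ext_coord hj hi
    exact h₁ m hm hp (this ▸ hp')
  · refine h₂ m hm hp ?_
    rw [← hp', power, power, hm, hm', Plane.inner_eq, Plane.inner_eq]
    fin_cases i <;> simp_all

lemma Plane.exists_single {m : Plane} {i : Fin 2} (h : m i.rev = 0) :
    m = EuclideanSpace.single i (m i) := by
  fin_cases i
  · exact Plane.ext_coord (by simp) (by simpa using h)
  · exact Plane.ext_coord (by simpa using h) (by simp)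

lemma Plane.abs_apply_eq {m : Plane} {i : Fin 2} (h : m i.rev = 0) : |m i| = ‖m‖ := by
  conv_rhs => rw [Plane.exists_single h]
  simp

lemma Plane.rev_eq_zero {m : Plane} {i : Fin 2} (h : |m i| = ‖m‖) : m i.rev = 0 := by
  have := Plane.norm_sq_eq m
  rw [← h, sq_abs] at this
  fin_cases i <;> simp_all

/-- The coordinates of a corner are neither that of the center nor those of the poles. -/
lemma eventually_corner_apply {n : Plane} (i : Fin 2) (h₀ : n i ≠ 0) (h₁ : n i.rev ≠ 0) :
    ∀ᶠ r in 𝓝[>] (0 : ℝ), ∀ m : Plane, ‖m‖ = r → power n m = 0 → m i ≠ 0 ∧ |m i| ≠ r := by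
  filter_upwards [eventually_power_single_ne h₀, eventually_power_single_ne h₁]
    with r h h' m hm hp
  constructor
  · intro h0
    have hrev : m (i.rev).rev = 0 := by rwa [Fin.rev_rev]
    refine h' (m i.rev) ((Plane.abs_apply_eq hrev).trans hm) ?_
    rwa [← Plane.exists_single hrev]
  · intro h0
    have hrev := Plane.rev_eq_zero (h0.trans hm.symm)
    refine h (m i) h0 ?_
    rwa [← Plane.exists_single hrev]

/-- Old vertices other than the class of `p` survive the addition of a small circle centered at `p`,
and the labels of the old vertices are not close to `p i` unless they are equal to it. -/
lemma WellPlaced.eventually_specialPoints {S : Set PlaneCircle} {D : Set Plane}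
    (h : WellPlaced S D) (p : Plane) (i : Fin 2) : ∀ᶠ r in 𝓝[>] (0 : ℝ),
      ∀ x ∈ closure D ∩ specialPoints S i,
        (x ≠ p → x ∈ closure (D \ Metric.closedBall p r)) ∧ (x i ≠ p i → r < |x i - p i|) := by
  refine (eventually_all_finite ((h.finite_specialPoints i).subset inter_subset_right)).2 ?_
  intro x hx
  have far : ∀ᶠ r in 𝓝[>] (0 : ℝ), x ≠ p → r < dist x p := by
    by_cases hxp : x = p
    · simp [hxp]
    · exact (eventually_lt_nhdsGT (dist_pos.2 hxp)).mono fun r hr _ => hr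
  filter_upwards [far, eventually_lt_abs (x i - p i)] with r hr hr'
  refine ⟨fun hxp => ?_, fun hxp => hr' (sub_ne_zero.2 hxp)⟩
  rw [sdiff_eq, inter_comm]
  refine (Metric.isClosed_closedBall.isOpen_compl).inter_closure ⟨?_, hx.1⟩
  rw [mem_compl_iff, Metric.mem_closedBall, not_le]
  exact hr hxp

/-- If both sides of a sector point to different sides of the line through the apex in the direction
of a coordinate axis, the sector opens in the direction of this axis. -/
lemma sector_opens {n₁ n₂ v w : Plane} {σ₁ σ₂ : ℝ} {i : Fin 2} (s₁ : σ₁ * σ₁ = 1)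
    (s₂ : σ₂ * σ₂ = 1) (h₁ : n₁ i ≠ 0) (h₂ : n₂ i ≠ 0) (hv : inner ℝ n₁ v = 0)
    (hw : inner ℝ n₂ w = 0) (hv' : 0 < σ₂ * inner ℝ n₂ v) (hw' : 0 < σ₁ * inner ℝ n₁ w)
    (hj : v i.rev * w i.rev < 0) : 0 < (σ₁ * n₁ i) * (σ₂ * n₂ i) := by
  have inner_rev : ∀ x y : Plane, inner ℝ x y = x i * y i + x i.rev * y i.rev := by
    intro x y
    rw [Plane.inner_eq]
    fin_cases i
    · rfl
    · exact add_comm _ _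
  rw [inner_rev] at hv hw hv' hw'
  have hprod := mul_pos hv' hw'
  have hne : (σ₁ * n₁ i) * (σ₂ * n₂ i) ≠ 0 := by
    have e₁ : σ₁ ≠ 0 := left_ne_zero_of_mul (s₁.trans_ne one_ne_zero)
    have e₂ : σ₂ ≠ 0 := left_ne_zero_of_mul (s₂.trans_ne one_ne_zero)
    positivity
  -- Tangency eliminates `v i` and `w i`; the two positive inner products times the target become
  -- `-(v i.rev * w i.rev)` times the square of a determinant.
  have e : σ₂ * (n₂ i * v i + n₂ i.rev * v i.rev) * (σ₁ * (n₁ i * w i + n₁ i.rev * w i.rev)) *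
      ((σ₁ * n₁ i) * (σ₂ * n₂ i)) =
      -(v i.rev * w i.rev) * (n₁ i * n₂ i.rev - n₁ i.rev * n₂ i) ^ 2 := by
    have e₁ : n₁ i * (n₂ i * v i + n₂ i.rev * v i.rev) =
        v i.rev * (n₁ i * n₂ i.rev - n₁ i.rev * n₂ i) := by
      linear_combination n₂ i * hv
    have e₂ : n₂ i * (n₁ i * w i + n₁ i.rev * w i.rev) =
        -(w i.rev * (n₁ i * n₂ i.rev - n₁ i.rev * n₂ i)) := by
      linear_combination n₁ i * hw
    calc _ = (σ₁ * σ₁) * (σ₂ * σ₂) * (n₁ i * (n₂ i * v i + n₂ i.rev * v i.rev)) *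
          (n₂ i * (n₁ i * w i + n₁ i.rev * w i.rev)) := by ring
      _ = _ := by
        rw [s₁, s₂, e₁, e₂]
        ring
  refine lt_of_le_of_ne ?_ hne.symm
  refine nonneg_of_mul_nonneg_right ?_ hprod
  rw [e]
  exact mul_nonneg (neg_nonneg.2 hj.le) (sq_nonneg _)

/-- Two corners and a pole contribute three new labels, but a split accounts for only two. -/
lemma WellPlaced.eventually_not_equalLabelSplit {S : Set PlaneCircle} {D : Set Plane}
    (h : WellPlaced S D) {p : Plane} {c₁ c₂ : PlaneCircle} (hp : IsDoublePoint S D p c₁ c₂)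
    (i : Fin 2) : ∀ᶠ r in 𝓝[>] (0 : ℝ), ∀ hr : 0 < r, ¬ EqualLabelSplit S D p r hr c₁ c₂ i := by
  obtain ⟨σ₁, σ₂, ε, sec⟩ := h.exists_isSector hp
  obtain ⟨hrad, hcr, -⟩ := h.crossing c₁ hp.mem₁ c₂ hp.mem₂ hp.ne p hp.on₁ hp.on₂
  rw [← PlaneCircle.mem_carrier.1 hp.on₁, ← PlaneCircle.mem_carrier.1 hp.on₂] at hrad
  obtain ⟨n₁, hn₁⟩ : ∃ n, n = p - c₁.center := ⟨_, rfl⟩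
  obtain ⟨n₂, hn₂⟩ : ∃ n, n = p - c₂.center := ⟨_, rfl⟩
  rw [← hn₁, ← hn₂] at sec hrad hcr
  -- both canonical segments are transversal to the coordinate axes
  have tangent : ∀ n v : Plane, n ≠ 0 → inner ℝ n v = 0 → v i ≠ 0 → v i.rev ≠ 0 →
      n i ≠ 0 ∧ n i.rev ≠ 0 := by
    intro n v hn hnv h₀ h₁
    rw [Plane.inner_eq] at hnv
    have hz : n i = 0 ∨ n i.rev = 0 → n = 0 := by
      intro hz
      fin_cases i <;> rcases hz with hz | hz <;> refine Plane.ext_coord ?_ ?_ <;> simp_all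
    exact ⟨fun h => hn (hz (Or.inl h)), fun h => hn (hz (Or.inr h))⟩
  -- If a normal is parallel to an axis, a canonical segment has a zero coordinate and the strict
  -- sign conditions fail for every `r`.
  by_cases hne : (n₁ i ≠ 0 ∧ n₁ i.rev ≠ 0) ∧ n₂ i ≠ 0 ∧ n₂ i.rev ≠ 0
  swap
  · filter_upwards with r hr ⟨⟨v, w, hv, hw, hi, hj⟩, _⟩
    refine hne ⟨tangent n₁ v (ne_zero_left_of_cross hcr) (hn₁ ▸ hv.1) (left_ne_zero_of_mul hi.ne')
      (left_ne_zero_of_mul hj.ne), tangent n₂ w (ne_zero_right_of_cross hcr) (hn₂ ▸ hw.1)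
      (right_ne_zero_of_mul hi.ne') (right_ne_zero_of_mul hj.ne)⟩
  obtain ⟨⟨h10, h11⟩, h20, h21⟩ := hne
  have hpole : ∀ᶠ r in 𝓝[>] (0 : ℝ), 0 < (σ₁ * n₁ i) * (σ₂ * n₂ i) →
      ∃ t, |t| = r ∧ 0 ≤ σ₁ * power n₁ (EuclideanSpace.single i t) ∧
        0 ≤ σ₂ * power n₂ (EuclideanSpace.single i t) := by
    by_cases hs : 0 < (σ₁ * n₁ i) * (σ₂ * n₂ i)
    · exact (eventually_exists_pole sec.sign₁ sec.sign₂ hs).mono fun r hr _ => hr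
    · simp [hs]
  filter_upwards [sec.eventually_mem_closure, sec.eventually_canonical, sec.swap.eventually_canonical,
    eventually_exists_corner sec.cross_ne sec.sign₂, eventually_exists_corner sec.swap.cross_ne
    sec.sign₁, hpole, eventually_corners_ne hrad i, eventually_corner_apply i h10 h11,
    eventually_corner_apply i h20 h21, h.eventually_specialPoints p i]
    with r hcl can₁ can₂ ⟨m₁, hm₁, hp₁, hs₁⟩ ⟨m₂, hm₂, hp₂, hs₂⟩ pole hmm apply₁ apply₂ old hr
  rintro ⟨⟨v, w, hv, hw, hi, hj⟩, hsplit⟩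
  have hv' := can₁ v (hn₁ ▸ hv.1) hv.2.1 hv.2.2
  have hw' := can₂ w (hn₂ ▸ hw.1) hw.2.1 hw.2.2
  -- the sector opens in the direction of a coordinate axis
  have hopen : 0 < (σ₁ * n₁ i) * (σ₂ * n₂ i) :=
    sector_opens sec.sign₁ sec.sign₂ h10 h20 (hn₁ ▸ hv.1) (hn₂ ▸ hw.1) hv' hw' hj
  obtain ⟨t, ht, ht₁, ht₂⟩ := pole hopen
  set S' : Set PlaneCircle := insert ⟨p, r, hr⟩ S with hS'
  set D' : Set Plane := D \ Metric.closedBall p r with hD'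
  set L := range (poincareReeb S D i).label with hL
  set L' := range (poincareReeb S' D' i).label with hL'
  have hnew : ∀ c ∈ S, p ∈ c.carrier → ∀ m : Plane, ‖m‖ = r → power (p - c.center) m = 0 →
      p + m ∈ specialPoints S' i := by
    intro c hc hpc m hm hpm
    have hmem : p + m ∈ c.carrier := by
      rw [← PlaneCircle.power_eq_zero hpc, add_sub_cancel_left, hpm]
    refine Or.inr ⟨⟨p, r, hr⟩, mem_insert _ _, c, mem_insert_of_mem _ hc, ?_, ?_, hmem⟩
    · rintro rfl
      rw [PlaneCircle.mem_carrier, sub_self, norm_zero] at hpc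
      exact hr.ne hpc
    · rw [PlaneCircle.mem_carrier]
      simpa using hm
  have mem_L' : ∀ x ∈ closure D', x ∈ specialPoints S' i → x i ∈ L' := fun x hx hx' => by
    rw [hL', range_poincareReeb_label]
    exact ⟨x, ⟨hx, hx'⟩, rfl⟩
  have k₁ : p i + m₁ i ∈ L' := mem_L' (p + m₁)
    (hcl m₁ hm₁ (by rw [hp₁, mul_zero]) hs₁) (hnew c₁ hp.mem₁ hp.on₁ m₁ hm₁ (hn₁ ▸ hp₁))
  have k₂ : p i + m₂ i ∈ L' := mem_L' (p + m₂)
    (hcl m₂ hm₂ hs₂ (by rw [hp₂, mul_zero])) (hnew c₂ hp.mem₂ hp.on₂ m₂ hm₂ (hn₂ ▸ hp₂))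
  have k₃ : p i + t ∈ L' := by
    have := mem_L' (p + EuclideanSpace.single i t) (hcl _ (by simpa using ht) ht₁ ht₂)
      (Or.inl ⟨⟨p, r, hr⟩, mem_insert _ _, ?_⟩)
    · simpa using this
    · rcases abs_eq hr.le |>.1 ht with rfl | rfl
      · exact Or.inl rfl
      · right
        ext j
        by_cases hj : j = i <;> simp [hj, sub_eq_add_neg]
  have hsurv : ∀ x ∈ closure D ∩ specialPoints S i, x ≠ p → x i ∈ L' := fun x hx hxp =>
    mem_L' x ((old x hx).1 hxp) (specialPoints_mono (subset_insert _ _) i hx.2)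
  have hfar : ∀ s, |s| ≤ r → s ≠ 0 → p i + s ∉ L := by
    intro s hs hs0 hmem
    rw [hL, range_poincareReeb_label] at hmem
    obtain ⟨x, hx, hxs⟩ := hmem
    have hxs : x i = p i + s := hxs
    have := (old x hx).2 (by rw [hxs]; simpa using hs0)
    rw [hxs, add_sub_cancel_left] at this
    exact hs.not_gt this
  have t0 : t ≠ 0 := by rintro rfl; simp at ht; exact hr.ne ht
  obtain ⟨a₁, b₁⟩ := apply₁ m₁ hm₁ hp₁
  obtain ⟨a₂, b₂⟩ := apply₂ m₂ hm₂ hp₂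
  set N : Set ℝ := {p i + m₁ i, p i + m₂ i, p i + t} with hN
  have hNcard : N.encard = 3 := by
    rw [encard_eq_three]
    refine ⟨_, _, _, ?_, ?_, ?_, rfl⟩
    · simpa using hmm m₁ m₂ hm₁ hm₂ hp₁ hp₂
    · intro e
      exact b₁ (by rw [add_left_cancel e, ht])
    · intro e
      exact b₂ (by rw [add_left_cancel e, ht])
  have hNL : Disjoint L N := by
    rw [disjoint_right]
    rintro _ (rfl | rfl | rfl)
    · exact hfar _ ((Plane.abs_apply_le _ _).trans_eq hm₁) a₁
    · exact hfar _ ((Plane.abs_apply_le _ _).trans_eq hm₂) a₂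
    · exact hfar _ ht.le t0
  have hNL' : N ⊆ L' := by
    rintro _ (rfl | rfl | rfl)
    exacts [k₁, k₂, k₃]
  have hfin : L.Finite := by
    rw [hL, range_poincareReeb_label]
    exact ((h.finite_specialPoints i).subset inter_subset_right).image _
  have hdiff : L \ {p i} ⊆ L' := by
    rintro _ ⟨hx, hxp⟩
    rw [hL, range_poincareReeb_label] at hx
    obtain ⟨x, hx, rfl⟩ := hx
    exact hsurv x hx (by rintro rfl; exact hxp rfl)
  -- Used with `K = L` or `K = L \ {p i}`, according to whether a second vertex has the label `p i`.
  -- Finiteness of `L` is what makes `K.encard + 3 ≤ K.encard + 2` absurd.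
  have contra : ∀ K ⊆ L, K ⊆ L' → ¬ L'.encard ≤ K.encard + 2 := by
    intro K hK hK' hle
    have h3 : K.encard + 3 ≤ K.encard + 2 := by
      rw [← hNcard, ← encard_union_eq (hNL.mono_left hK)]
      exact (encard_le_encard (union_subset hK' hNL')).trans hle
    rw [(hfin.subset hK).encard_eq_coe] at h3
    norm_cast at h3
    omega
  rcases hsplit.encard_range_label_le with hle | ⟨⟨v, w, hvw, hlv, hlw⟩, hle⟩
  · exact contra _ sdiff_subset hdiff hle
  · refine contra L subset_rfl (fun x hx => ?_) hle
    by_cases hxp : x = p i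
    · obtain ⟨y, hy, hyp, hyi⟩ := exists_specialPoint_ne hvw hlv hlw p
      rw [hxp, ← hyi]
      exact hsurv y hy hyp
    · exact hdiff ⟨hx, hxp⟩

/-! ### The theorem -/

/-- The bound may depend on `S`, `D`, `p` only. Finiteness of `S` makes it uniform in the two
circles, and the value `1` is a default where `WellPlaced` fails. -/
lemma WellPlaced.exists_radius (S : Set PlaneCircle) (D : Set Plane) (p : Plane) :
    ∃ δ > 0, WellPlaced S D → ∀ (r : ℝ) (hr : 0 < r), r < δ →
      WellPlaced (insert ⟨p, r, hr⟩ S) (D \ Metric.closedBall p r) ∧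
      ∀ c₁ c₂, IsDoublePoint S D p c₁ c₂ → ∀ i, ¬ EqualLabelSplit S D p r hr c₁ c₂ i := by
  by_cases h : WellPlaced S D
  swap
  · exact ⟨1, one_pos, fun h' => absurd h' h⟩
  have hsplit : ∀ᶠ r in 𝓝[>] (0 : ℝ), ∀ c₁ ∈ S, ∀ c₂ ∈ S, ∀ i, ∀ hr : 0 < r,
      IsDoublePoint S D p c₁ c₂ → ¬ EqualLabelSplit S D p r hr c₁ c₂ i := by
    refine (eventually_all_finite h.finite).2 fun c₁ _ => (eventually_all_finite h.finite).2
      fun c₂ _ => eventually_all.2 fun i => ?_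
    by_cases hp : IsDoublePoint S D p c₁ c₂
    · exact (h.eventually_not_equalLabelSplit hp i).mono fun r h hr _ => h hr
    · simp [hp]
  obtain ⟨δ, hδ, hall⟩ := mem_nhdsGT_iff_exists_Ioo_subset.1 ((h.eventually_step p).and hsplit)
  refine ⟨δ, hδ, fun _ r hr hrδ => ⟨(hall ⟨hr, hrδ⟩).1 hr, fun c₁ c₂ hp i => ?_⟩⟩
  exact (hall ⟨hr, hrδ⟩).2 c₁ hp.mem₁ c₂ hp.mem₂ i hr hp

theorem theorem4 :
    ∃ δ : Set PlaneCircle → Set Plane → Plane → ℝ,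
      (∀ (S : Set PlaneCircle) (D : Set Plane) (p : Plane), 0 < δ S D p) ∧
      ∀ (S : Set PlaneCircle) (D : Set Plane), IsCircleCentered δ S D →
        ∀ (p : Plane) (c₁ c₂ : PlaneCircle), IsDoublePoint S D p c₁ c₂ →
          ∀ (r : ℝ) (hr : 0 < r), r < δ S D p →
            ¬ SameQuadrant D p r c₁ c₂ ∧
            (∀ i : Fin 2, ¬ EqualLabelSplit S D p r hr c₁ c₂ i) ∧
            ¬ OppositeQuadrants D p r c₁ c₂ := by
  choose δ hδ hall using WellPlaced.exists_radius
  refine ⟨δ, hδ, fun S D harr p c₁ c₂ hp r hr hrδ => ?_⟩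
  have h : WellPlaced S D := by
    clear hp hrδ
    induction harr with
    | base finite _ disjoint region _ => exact WellPlaced.base finite disjoint region
    | step _ _ _ pos small ih => exact (hall _ _ _ ih _ pos small).1
  refine ⟨?_, (hall S D p h r hr hrδ).2 c₁ c₂ hp, ?_⟩
  · rintro ⟨v, w, hv, hw, h₀, h₁⟩
    exact (h.segments_mul_nonpos hp hv.1 hw.1).not_gt (mul_pos h₀ h₁)
  · rintro ⟨v, w, hv, hw, h₀, h₁⟩
    exact (h.segments_mul_nonpos hp hv.1 hw.1).not_gt (mul_pos_of_neg_of_neg h₀ h₁)
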